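/- Let $G=(V,E)$ be a finite connected simple graph. A lazy simple random walk on $G$ stays put with probability $1/2$ and otherwise moves to a uniformly chosen neighbour of its current vertex; let $P$ be its transition matrix. The spectral gap of $G$ is the smallest non-zero eigenvalue of $I-P$, and $G$ is a $\lambda$-expander if its spectral gap is at least $\lambda$. In the random walks social network model on $G$, the numbers $N_v$ of walkers starting at the vertices $v \in V$ are independent, $N_v \sim \mathrm{Poisson}(|V| d_v/(2|E|))$ where $d_v$ is the degree of $v$, and all the walkers simultaneously perform independent lazy simple random walks on $G$. Two walkers have met by time $t$ if they have the same position at some time $t_0 \le t$; two walkers are in the same class at time $t$ if they are joined by a finite chain of walkers in which any two consecutive walkers have met by time $t$. Theorem. There exist absolute constants $c, C_1 > 0$ such that the following holds for all $n \ge 2$, all $d$ and all $\lambda > 0$. Let $G$ be a connected $d$-regular $n$-vertex $\lambda$-expander and let $s := \lceil C_1/\lambda \rceil$. Then, with probability at least $1 - \exp\left(-c\, n\, d^{-4(s+1)}\right)$, at time $s$ there exists a class of walkers of size at least $n/6$. -/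

import Mathlib

open MeasureTheory ProbabilityTheory
open scoped ENNReal NNReal

namespace SocialNetwork

section Walk

variable {V : Type*} [Fintype V] [DecidableEq V]

/-- Transition probabilities of the lazy simple random walk: stay put with probability `1/2`, move
to each of the `d_u` neighbours with probability `1/(2 d_u)` (an isolated vertex is absorbing). -/
noncomputable def lazyP (G : SimpleGraph V) [DecidableRel G.Adj] : Matrix V V ℝ :=
  fun u v =>
    if v = u then (if G.degree u = 0 then 1 else 1 / 2)
    else if G.Adj u v then 1 / (2 * (G.degree u : ℝ)) else 0

variable (G : SimpleGraph V) [DecidableRel G.Adj]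

lemma lazyP_nonneg (u v : V) : 0 ≤ lazyP G u v := by
  unfold lazyP
  split_ifs <;> positivity

lemma sum_lazyP (u : V) : ∑ v, lazyP G u v = 1 := by
  have h : ∀ v, lazyP G u v =
      (if v = u then (if G.degree u = 0 then (1 : ℝ) else 1 / 2) else 0) +
        (if v ∈ G.neighborFinset u then 1 / (2 * (G.degree u : ℝ)) else 0) := by
    intro v
    unfold lazyP
    by_cases hv : v = u
    · subst hv; simp
    · simp [hv]
  rw [Finset.sum_congr rfl (fun v _ => h v), Finset.sum_add_distrib]
  simp only [Finset.sum_ite_eq', Finset.mem_univ, if_true, Finset.sum_ite_mem, Finset.univ_inter,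
    Finset.sum_const, G.card_neighborFinset_eq_degree, nsmul_eq_mul]
  by_cases hd : G.degree u = 0
  · simp [hd]
  · have : (G.degree u : ℝ) ≠ 0 := by exact_mod_cast hd
    simp only [hd, if_false]
    field_simp
    norm_num

/-- The law of one step of the lazy simple random walk from `u`. -/
noncomputable def lazyStep (u : V) : PMF V :=
  PMF.ofFintype (fun v => ENNReal.ofReal (lazyP G u v)) (by
    rw [← ENNReal.ofReal_sum_of_nonneg (fun v _ => lazyP_nonneg G u v), sum_lazyP,
      ENNReal.ofReal_one])

/-- The spectral gap: the smallest non-zero eigenvalue of `I - P`. -/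
noncomputable def spectralGap : ℝ :=
  sInf {μ : ℝ | μ ≠ 0 ∧ Module.End.HasEigenvalue (Matrix.toLin' (1 - lazyP G)) μ}

/-- `G` is a `lam`-expander if its spectral gap is at least `lam`. -/
def IsExpander (lam : ℝ) : Prop := lam ≤ spectralGap G

/-- The mean number `|V| d_v / (2|E|)` of walkers starting at `v`. -/
noncomputable def startMean (v : V) : ℝ≥0 :=
  (Fintype.card V : ℝ≥0) * ((G.degree v : ℝ≥0) / (2 * (G.edgeFinset.card : ℝ≥0)))

variable [MeasurableSpace V] [DiscreteMeasurableSpace V]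

/-- The one-step transition kernel of the lazy simple random walk. -/
noncomputable def lazyKernel : Kernel V V where
  toFun u := (lazyStep G u).toMeasure
  measurable' := Measurable.of_discrete

instance : IsMarkovKernel (lazyKernel G) :=
  ⟨fun u => inferInstanceAs (IsProbabilityMeasure (lazyStep G u).toMeasure)⟩

/-- The law on `ℕ → V` of the trajectory of a lazy simple random walk started at `v`. -/
noncomputable def walkLaw (v : V) : Measure (ℕ → V) :=
  Kernel.traj (X := fun _ => V)
    (fun k => (lazyKernel G).comap
      (fun x : (i : Finset.Iic k) → V => x ⟨k, Finset.mem_Iic.2 le_rfl⟩)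
      (measurable_pi_apply _)) 0 (fun _ => v)

instance (v : V) : IsProbabilityMeasure (walkLaw G v) := by
  unfold walkLaw; infer_instance

end Walk

/-- A configuration: at each vertex `v`, the number of walkers that start at `v` together with the
trajectories of an infinite supply of potential walkers starting at `v`; only the first
`(ω v).1` of these are actually present. -/
abbrev Config (V : Type*) : Type _ := V → ℕ × (ℕ → ℕ → V)

/-- The law of the social network model: independently over the vertices `v`, the number of
walkers starting at `v` is Poisson with mean `startMean G v`, and, independently of this number and
of each other, the walkers starting at `v` perform lazy simple random walks from `v`. -/
noncomputable def modelLaw {V : Type*} [Fintype V] [DecidableEq V] [MeasurableSpace V]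
    [DiscreteMeasurableSpace V] (G : SimpleGraph V) [DecidableRel G.Adj] : Measure (Config V) :=
  Measure.pi fun v => (poissonMeasure (startMean G v)).prod
    (Measure.infinitePi fun _ : ℕ => walkLaw G v)

instance {V : Type*} [Fintype V] [DecidableEq V] [MeasurableSpace V]
    [DiscreteMeasurableSpace V] (G : SimpleGraph V) [DecidableRel G.Adj] :
    IsProbabilityMeasure (modelLaw G) := by
  unfold modelLaw; infer_instance

section Acquaintance

variable {V : Type*}

/-- The walkers present in the configuration `ω`: the walker `(v, i)` with `i < (ω v).1` is the
`i`-th one starting at `v`. -/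
abbrev Walker (ω : Config V) : Type _ := {w : V × ℕ // w.2 < (ω w.1).1}

/-- The position of a walker at time `t`. -/
def position (ω : Config V) (w : Walker ω) (t : ℕ) : V := (ω w.1.1).2 w.1.2 t

/-- Two walkers have met by time `t`. -/
def MetBy (ω : Config V) (t : ℕ) (a b : Walker ω) : Prop :=
  ∃ t₀ ≤ t, position ω a t₀ = position ω b t₀

/-- Two walkers have a path of acquaintances by time `t`. -/
def Acquainted (ω : Config V) (t : ℕ) : Walker ω → Walker ω → Prop :=
  Relation.TransGen (MetBy ω t)

/-- The class of a walker at time `t`. -/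
def acquaintanceClass (ω : Config V) (t : ℕ) (a : Walker ω) : Set (Walker ω) :=
  {b | Acquainted ω t a b}

end Acquaintance

end SocialNetwork

/-! On a regular graph every starting mean is `1`, so a vertex has a walker with probability `1 -
1/e > 0.63`. When `n ≥ 40000`, only the first walker of each vertex is used, and it is identified
with that vertex. The time `s` is split as `t + r`, both halves being large multiples of the
relaxation time `1/lam`.

In the first phase, fix the trajectory of one walker. Summed over all starting vertices, the
expected number of coincidences with it is `t + 1`, because the transition matrix is doubly
stochastic. Once a coincidence occurs, at most `(t + 1)/n + 1/lam` are expected from then on. By the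
second moment method the trajectory is thus met by thousands of walkers in expectation
(`le_sum_sum_pathWeight_hit`). Exponential moments show that a present walker very probably has at
least `2800` contacts and shares its place at time `t` with at most `200` walkers. Call its vertex
good. The expected number of good vertices is at least `3n/5`. Changing one walker affects at most
`(d + 1) ^ (2 * t)` vertices, so McDiarmid's inequality gives `n/2` good vertices with high
probability (`prodExp_card_good_lt_le`).

The second phase is sprinkling (`prodExp_forall_class_lt_le`). By the Markov property the walkers
continue independently for `r` steps. Good vertices lie in classes of size at least `2800`, so at
most `n/2800` classes are involved. If all final classes were smaller than `n/6`, the good vertices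
could be split along the old classes into two parts of at least `n/6` vertices with no coincidence
at time `s`. Such parts are not crowded, so after mixing each is expected to cover most of the
graph, and a given split avoids coincidences with probability at most `exp (-n/1400)`
(`prodExp_forall_ne_le`). There are at most `exp (n/2800)` splits, so a union bound suffices.

For `n < 40000` it is enough that some vertex starts with `40000` walkers, an event whose
probability is a positive constant. -/

namespace SocialNetwork

/-! ### Finite product expectations, resampling and McDiarmid's inequality -/

section ProductExpectation

variable {ι Ω : Type*} [Fintype ι] [Fintype Ω]

/-- A family of probability weights on a finite type. -/
structure IsWeight (p : ι → Ω → ℝ) : Prop where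
  nonneg : ∀ i ω, 0 ≤ p i ω
  sum_eq_one : ∀ i, ∑ ω, p i ω = 1

lemma IsWeight.prod_nonneg {p : ι → Ω → ℝ} (hp : IsWeight p) (x : ι → Ω) : 0 ≤ ∏ i, p i (x i) :=
  Finset.prod_nonneg fun i _ => hp.nonneg i (x i)

variable [DecidableEq ι]

/-- The expectation of `f` under the product over `i` of the weights `p i` on a finite type. -/
def prodExp (p : ι → Ω → ℝ) (f : (ι → Ω) → ℝ) : ℝ :=
  ∑ x : ι → Ω, (∏ i, p i (x i)) * f x

lemma prodExp_prod (p g : ι → Ω → ℝ) :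
    prodExp p (fun x => ∏ i, g i (x i)) = ∏ i, ∑ ω, p i ω * g i ω := by
  unfold prodExp
  rw [Finset.prod_univ_sum, Fintype.piFinset_univ]
  exact Finset.sum_congr rfl fun x _ => Finset.prod_mul_distrib.symm

lemma prodExp_congr {p : ι → Ω → ℝ} {f g : (ι → Ω) → ℝ} (h : ∀ x, f x = g x) :
    prodExp p f = prodExp p g := by
  rw [funext h]

lemma prodExp_mul_left (p : ι → Ω → ℝ) (c : ℝ) (f : (ι → Ω) → ℝ) :
    prodExp p (fun x => c * f x) = c * prodExp p f := by
  simp only [prodExp, Finset.mul_sum]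
  exact Finset.sum_congr rfl fun x _ => by ring

lemma prodExp_mul_right (p : ι → Ω → ℝ) (c : ℝ) (f : (ι → Ω) → ℝ) :
    prodExp p (fun x => f x * c) = prodExp p f * c := by
  simp only [prodExp, Finset.sum_mul]
  exact Finset.sum_congr rfl fun x _ => by ring

lemma prodExp_add (p : ι → Ω → ℝ) (f g : (ι → Ω) → ℝ) :
    prodExp p (fun x => f x + g x) = prodExp p f + prodExp p g := by
  simp only [prodExp, mul_add, Finset.sum_add_distrib]

lemma prodExp_sub (p : ι → Ω → ℝ) (f g : (ι → Ω) → ℝ) :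
    prodExp p (fun x => f x - g x) = prodExp p f - prodExp p g := by
  simp only [prodExp, mul_sub, Finset.sum_sub_distrib]

lemma prodExp_sum {κ : Type*} (p : ι → Ω → ℝ) (s : Finset κ) (f : κ → (ι → Ω) → ℝ) :
    prodExp p (fun x => ∑ k ∈ s, f k x) = ∑ k ∈ s, prodExp p (f k) := by
  simp only [prodExp, Finset.mul_sum]
  exact Finset.sum_comm

namespace IsWeight

variable {p : ι → Ω → ℝ}

lemma prodExp_const (hp : IsWeight p) (c : ℝ) : prodExp p (fun _ => c) = c := by
  have := prodExp_prod p (fun _ _ => (1 : ℝ))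
  simp only [Finset.prod_const_one, mul_one, hp.sum_eq_one] at this
  have h2 := prodExp_mul_left p c (fun _ => 1)
  rw [this] at h2
  simpa using h2

/-- Discarding configurations of weight zero matters for trajectories: only possible trajectories
are known to stay within `reach` of their starting vertex. -/
lemma prodExp_mono_of_ne (hp : IsWeight p) {f g : (ι → Ω) → ℝ} (h : ∀ x, (∀ i, p i (x i) ≠ 0) → f x ≤ g x) :
    prodExp p f ≤ prodExp p g := by
  refine Finset.sum_le_sum fun x _ => ?_
  by_cases hx : ∀ i, p i (x i) ≠ 0
  · exact mul_le_mul_of_nonneg_left (h x hx) (hp.prod_nonneg x)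
  · push Not at hx
    obtain ⟨i, hi⟩ := hx
    simp [Finset.prod_eq_zero (f := fun i => p i (x i)) (Finset.mem_univ i) hi]

lemma prodExp_mono (hp : IsWeight p) {f g : (ι → Ω) → ℝ} (h : ∀ x, f x ≤ g x) : prodExp p f ≤ prodExp p g :=
  hp.prodExp_mono_of_ne fun x _ => h x

lemma prodExp_nonneg (hp : IsWeight p) {f : (ι → Ω) → ℝ} (h : ∀ x, 0 ≤ f x) : 0 ≤ prodExp p f :=
  (hp.prodExp_const 0).symm.le.trans (hp.prodExp_mono h)

/-- Resampling one coordinate does not change an expectation. -/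
lemma prodExp_update (hp : IsWeight p) (v : ι) (f : (ι → Ω) → ℝ) :
    prodExp p (fun x => ∑ ω, p v ω * f (Function.update x v ω)) = prodExp p f := by
  -- Exchanging the current value at `v` with the resampled one preserves the joint weight; `e`
  -- below is this involution.
  have key : ∀ (x : ι → Ω) (ω : Ω), (∏ i, p i (x i)) * p v ω =
      (∏ i, p i (Function.update x v ω i)) * p v (x v) := by
    intro x ω
    rw [← Finset.mul_prod_erase _ _ (Finset.mem_univ v),
      ← Finset.mul_prod_erase _ (fun i => p i (Function.update x v ω i)) (Finset.mem_univ v)]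
    rw [Finset.prod_congr rfl (g := fun i => p i (x i)) (s₂ := Finset.univ.erase v)
      (f := fun i => p i (Function.update x v ω i))
      (fun i hi => by rw [Function.update_of_ne (Finset.ne_of_mem_erase hi)])]
    simp only [Function.update_self]
    ring
  let e : ((ι → Ω) × Ω) ≃ ((ι → Ω) × Ω) :=
    { toFun := fun z => (Function.update z.1 v z.2, z.1 v)
      invFun := fun z => (Function.update z.1 v z.2, z.1 v)
      left_inv := fun z => by simp
      right_inv := fun z => by simp }
  calc prodExp p (fun x => ∑ ω, p v ω * f (Function.update x v ω))
      = ∑ z : (ι → Ω) × Ω, (∏ i, p i (z.1 i)) * p v z.2 * f (Function.update z.1 v z.2) := by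
        rw [Fintype.sum_prod_type]
        refine Finset.sum_congr rfl fun x _ => ?_
        rw [Finset.mul_sum]
        exact Finset.sum_congr rfl fun ω _ => by ring
    _ = ∑ z : (ι → Ω) × Ω, (∏ i, p i (z.1 i)) * p v z.2 * f z.1 := by
        rw [← e.sum_comp (fun z => (∏ i, p i (z.1 i)) * p v z.2 * f z.1)]
        refine Finset.sum_congr rfl fun z _ => ?_
        simp only [e, Equiv.coe_fn_mk]
        rw [key]
    _ = prodExp p f := by
        rw [Fintype.sum_prod_type]
        refine Finset.sum_congr rfl fun x _ => ?_
        simp only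
        rw [← Finset.sum_mul, ← Finset.mul_sum, hp.sum_eq_one, mul_one]

/-- Integrating out the coordinates in `B` of a product whose factors depend, apart from their own
coordinate, only on the coordinates outside `B`. -/
lemma prodExp_prod_mem (hp : IsWeight p) (B : Finset ι) (h : ι → Ω → (ι → Ω) → ℝ)
    (hB : ∀ v ∈ B, ∀ u ω x a, h u a (Function.update x v ω) = h u a x) :
    prodExp p (fun x => ∏ v ∈ B, h v (x v) x) =
      prodExp p (fun x => ∏ v ∈ B, ∑ ω, p v ω * h v ω x) := by
  -- The coordinates of `B` are averaged one at a time; `C` is the set of those already done.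
  suffices H : ∀ C ⊆ B, prodExp p (fun x => ∏ v ∈ B, h v (x v) x) =
      prodExp p (fun x => (∏ v ∈ C, ∑ ω, p v ω * h v ω x) * ∏ v ∈ B \ C, h v (x v) x) by
    simpa using H B subset_rfl
  intro C
  induction C using Finset.induction_on with
  | empty => intro _; simp
  | insert v C hv ih =>
    intro hC
    have hvB : v ∈ B := hC (Finset.mem_insert_self v C)
    rw [ih ((Finset.subset_insert v C).trans hC), ← hp.prodExp_update v]
    refine prodExp_congr fun x => ?_
    have hsd : B \ C = insert v (B \ insert v C) := by
      ext u; simp only [Finset.mem_sdiff, Finset.mem_insert]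
      by_cases huv : u = v
      · subst huv; simp [hvB, hv]
      · simp [huv]
    have hv2 : v ∉ B \ insert v C := by simp
    have h1 : ∀ ω, ∏ u ∈ B \ insert v C, h u (Function.update x v ω u) (Function.update x v ω) =
        ∏ u ∈ B \ insert v C, h u (x u) x := fun ω => by
      refine Finset.prod_congr rfl fun u hu => ?_
      have huv : u ≠ v := fun huv => hv2 (huv ▸ hu)
      rw [hB v hvB, Function.update_of_ne huv]
    simp only [hsd, Finset.prod_insert hv2, h1]
    simp only [hB v hvB, Function.update_self, Finset.prod_insert hv]
    rw [Finset.sum_mul, Finset.sum_mul]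
    exact Finset.sum_congr rfl fun ω _ => by ring

/-- Hoeffding's lemma on a finite probability space (with a non-optimal constant). -/
lemma _root_.SocialNetwork.sum_mul_exp_sub_le {q : Ω → ℝ} (hq : ∀ ω, 0 ≤ q ω)
    (hq1 : ∑ ω, q ω = 1) (g : Ω → ℝ) (c : ℝ) (hg : ∀ a b, |g a - g b| ≤ c) :
    ∑ a, q a * Real.exp (g a - ∑ b, q b * g b) ≤ Real.exp (c ^ 2 / 2) := by
  -- Symmetrisation: Jensen replaces the mean by an independent copy `b`. Exchanging `a` and `b`
  -- then turns `exp` into `cosh`, and `cosh x ≤ exp (x ^ 2 / 2)`.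
  have jensen : ∀ a, Real.exp (g a - ∑ b, q b * g b) ≤ ∑ b, q b * Real.exp (g a - g b) := by
    intro a
    have := convexOn_exp.map_sum_le (t := Finset.univ) (w := q) (p := fun b => g a - g b)
      (fun b _ => hq b) hq1 (fun b _ => Set.mem_univ _)
    simp only [smul_eq_mul, mul_sub, Finset.sum_sub_distrib, ← Finset.sum_mul, hq1, one_mul] at this
    exact this
  have h1 : ∑ a, q a * Real.exp (g a - ∑ b, q b * g b) ≤
      ∑ a, ∑ b, q a * q b * Real.exp (g a - g b) := by
    refine Finset.sum_le_sum fun a _ => ?_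
    refine (mul_le_mul_of_nonneg_left (jensen a) (hq a)).trans_eq ?_
    rw [Finset.mul_sum]
    exact Finset.sum_congr rfl fun b _ => by ring
  have h2 : ∑ a, ∑ b, q a * q b * Real.exp (g a - g b) =
      ∑ a, ∑ b, q a * q b * Real.exp (-(g a - g b)) := by
    rw [Finset.sum_comm]
    refine Finset.sum_congr rfl fun a _ => Finset.sum_congr rfl fun b _ => ?_
    rw [neg_sub, mul_comm (q b)]
  have h3 : ∑ a, ∑ b, q a * q b * Real.exp (g a - g b) =
      ∑ a, ∑ b, q a * q b * Real.cosh (g a - g b) := by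
    have : ∀ a b, q a * q b * Real.cosh (g a - g b) = (q a * q b * Real.exp (g a - g b) +
        q a * q b * Real.exp (-(g a - g b))) / 2 := fun a b => by rw [Real.cosh_eq]; ring
    simp only [this, ← Finset.sum_div, Finset.sum_add_distrib]
    rw [← h2]; ring
  rw [h3] at h1
  refine h1.trans ?_
  calc ∑ a, ∑ b, q a * q b * Real.cosh (g a - g b)
      ≤ ∑ a, ∑ b, q a * q b * Real.exp (c ^ 2 / 2) := by
        refine Finset.sum_le_sum fun a _ => Finset.sum_le_sum fun b _ => ?_
        refine mul_le_mul_of_nonneg_left ?_ (mul_nonneg (hq a) (hq b))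
        refine (Real.cosh_le_exp_half_sq _).trans (Real.exp_le_exp.2 ?_)
        have := sq_le_sq.2 ((hg a b).trans (le_abs_self c))
        linarith
    _ = Real.exp (c ^ 2 / 2) := by
        simp only [← Finset.sum_mul, ← Finset.mul_sum, hq1, mul_one, one_mul]

/-- McDiarmid's inequality for the moment generating function. -/
lemma prodExp_exp_sub_le (hp : IsWeight p) (f : (ι → Ω) → ℝ) (c : ι → ℝ)
    (hf : ∀ x v ω, |f (Function.update x v ω) - f x| ≤ c v) :
    prodExp p (fun x => Real.exp (f x - prodExp p f)) ≤ Real.exp (∑ v, c v ^ 2 / 2) := by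
  -- Induction on a set `S` of coordinates outside which `f` does not depend on its argument. The
  -- function `g` below averages out one coordinate and inherits the Lipschitz bounds.
  suffices H : ∀ (S : Finset ι) (f : (ι → Ω) → ℝ),
      (∀ x v ω, |f (Function.update x v ω) - f x| ≤ c v) →
      (∀ v ∉ S, ∀ x ω, f (Function.update x v ω) = f x) →
      prodExp p (fun x => Real.exp (f x - prodExp p f)) ≤ Real.exp (∑ v ∈ S, c v ^ 2 / 2) from
    H Finset.univ f hf (fun v hv => absurd (Finset.mem_univ v) hv)
  intro S
  induction S using Finset.induction_on with
  | empty =>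
    intro f _ hS
    have hconst : ∀ x y, f x = f y := by
      intro x y
      have : ∀ T : Finset ι, f (fun i => if i ∈ T then x i else y i) = f y := by
        intro T
        induction T using Finset.induction_on with
        | empty => simp
        | insert v T _ ih =>
          rw [← ih, ← hS v (by simp) (fun i => if i ∈ T then x i else y i) (x v)]
          congr 1
          ext i
          by_cases hi : i = v
          · subst hi; simp
          · simp [hi]
      simpa using this Finset.univ
    have : ∀ x, f x - prodExp p f = 0 := fun x => by
      rw [prodExp_congr (fun y => hconst y x), hp.prodExp_const, sub_self]
    simp [this, hp.prodExp_const]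
  | insert v S hv ih =>
    intro f hf hS
    set g : (ι → Ω) → ℝ := fun x => ∑ ω, p v ω * f (Function.update x v ω) with hg
    have hEg : prodExp p g = prodExp p f := hp.prodExp_update v f
    have hgv : ∀ x ω, g (Function.update x v ω) = g x := fun x ω => by simp [hg]
    have hsub : ∀ x x', g x - g x' =
        ∑ ω, p v ω * (f (Function.update x v ω) - f (Function.update x' v ω)) := fun x x' => by
      simp only [hg, mul_sub, Finset.sum_sub_distrib]
    have hgc : ∀ x u ω, |g (Function.update x u ω) - g x| ≤ c u := by
      intro x u ω
      by_cases huv : u = v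
      · subst huv; rw [hgv, sub_self, abs_zero]
        exact (abs_nonneg _).trans (hf x u ω)
      · rw [hsub]
        refine (Finset.abs_sum_le_sum_abs _ _).trans ?_
        calc _ ≤ ∑ a, p v a * c u := by
              refine Finset.sum_le_sum fun a _ => ?_
              rw [abs_mul, abs_of_nonneg (hp.nonneg v a), Function.update_comm huv]
              exact mul_le_mul_of_nonneg_left (hf _ _ _) (hp.nonneg v a)
          _ = c u := by rw [← Finset.sum_mul, hp.sum_eq_one, one_mul]
    have hgS : ∀ u ∉ S, ∀ x ω, g (Function.update x u ω) = g x := by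
      intro u hu x ω
      by_cases huv : u = v
      · subst huv; exact hgv x ω
      · simp only [hg]
        refine Finset.sum_congr rfl fun a _ => ?_
        rw [Function.update_comm huv, hS u (by simp [hu, huv])]
    have hcv : ∀ x a b, |f (Function.update x v a) - f (Function.update x v b)| ≤ c v := by
      intro x a b
      have := hf (Function.update x v b) v a
      rwa [Function.update_idem] at this
    calc prodExp p (fun x => Real.exp (f x - prodExp p f))
        = prodExp p (fun x => ∑ ω, p v ω * Real.exp (f (Function.update x v ω) - prodExp p f)) :=
          (hp.prodExp_update v _).symm
      _ ≤ prodExp p (fun x => Real.exp (g x - prodExp p g) * Real.exp (c v ^ 2 / 2)) := by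
          refine hp.prodExp_mono fun x => ?_
          calc ∑ ω, p v ω * Real.exp (f (Function.update x v ω) - prodExp p f)
              = Real.exp (g x - prodExp p g) *
                  ∑ ω, p v ω * Real.exp (f (Function.update x v ω) - g x) := by
                rw [Finset.mul_sum]
                refine Finset.sum_congr rfl fun ω _ => ?_
                rw [mul_left_comm, ← Real.exp_add, hEg]
                ring_nf
            _ ≤ _ := by
                refine mul_le_mul_of_nonneg_left ?_ (Real.exp_pos _).le
                exact sum_mul_exp_sub_le (hp.nonneg v) (hp.sum_eq_one v)
                  (fun ω => f (Function.update x v ω)) (c v) (hcv x)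
      _ ≤ Real.exp (∑ u ∈ S, c u ^ 2 / 2) * Real.exp (c v ^ 2 / 2) := by
          rw [prodExp_mul_right]
          exact mul_le_mul_of_nonneg_right (ih g hgc hgS) (Real.exp_pos _).le
      _ = Real.exp (∑ u ∈ insert v S, c u ^ 2 / 2) := by
          rw [Finset.sum_insert hv, ← Real.exp_add, add_comm]

end IsWeight

end ProductExpectation

/-! ### Spectral analysis of the lazy walk on a regular graph -/

section Spectral

open Matrix

lemma sum_sq_dotProduct_basis {V : Type*} [Fintype V] (b : OrthonormalBasis V ℝ (EuclideanSpace ℝ V)) (f : V → ℝ) :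
    ∑ i, ((b i).ofLp ⬝ᵥ f) ^ 2 = ∑ v, f v ^ 2 := by
  have := b.sum_sq_norm_inner_right (WithLp.toLp 2 f)
  rw [EuclideanSpace.norm_sq_eq] at this
  simpa [EuclideanSpace.inner_eq_star_dotProduct, dotProduct_comm f] using this

variable {V : Type*} [Fintype V] [DecidableEq V] (G : SimpleGraph V) [DecidableRel G.Adj]

/-- Laziness enters here: it lets the walk be back at its start at every time, so that `reach` grows
with time, and it makes the transition matrix positive semidefinite. -/
lemma half_le_lazyP_self (u : V) : 1 / 2 ≤ lazyP G u u := by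
  unfold lazyP
  split_ifs <;> norm_num at *

lemma lazyP_pow_nonneg (k : ℕ) (u v : V) : 0 ≤ (lazyP G ^ k) u v := by
  induction k generalizing u v with
  | zero => rw [pow_zero, Matrix.one_apply]; split_ifs <;> norm_num
  | succ k ih =>
    rw [pow_succ, Matrix.mul_apply]
    exact Finset.sum_nonneg fun w _ => mul_nonneg (ih u w) (lazyP_nonneg G w v)

lemma sum_lazyP_pow (k : ℕ) (u : V) : ∑ v, (lazyP G ^ k) u v = 1 := by
  induction k generalizing u with
  | zero => simp [Matrix.one_apply]
  | succ k ih =>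
    simp only [pow_succ, Matrix.mul_apply]
    rw [Finset.sum_comm]
    simp only [← Finset.mul_sum, sum_lazyP, mul_one, ih]

lemma lazyP_pow_self_pos (k : ℕ) (u : V) : 0 < (lazyP G ^ k) u u := by
  induction k with
  | zero => simp
  | succ k ih =>
    rw [pow_succ, Matrix.mul_apply]
    refine Finset.sum_pos' (fun w _ => mul_nonneg (lazyP_pow_nonneg G k u w) (lazyP_nonneg G w u))
      ⟨u, Finset.mem_univ u, mul_pos ih ?_⟩
    linarith [half_le_lazyP_self G u]

lemma lazyP_pow_add_ne_zero {i j : ℕ} {u v w : V} (h₁ : (lazyP G ^ i) u v ≠ 0)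
    (h₂ : (lazyP G ^ j) v w ≠ 0) : (lazyP G ^ (i + j)) u w ≠ 0 := by
  rw [pow_add, Matrix.mul_apply]
  refine (Finset.sum_pos' (fun a _ => mul_nonneg (lazyP_pow_nonneg G i u a)
    (lazyP_pow_nonneg G j a w)) ⟨v, Finset.mem_univ v, mul_pos ?_ ?_⟩).ne'
  · exact (lazyP_pow_nonneg G i u v).lt_of_ne' h₁
  · exact (lazyP_pow_nonneg G j v w).lt_of_ne' h₂

lemma lazyP_pow_ne_zero_of_le {i k : ℕ} (hik : i ≤ k) {u v : V} (h : (lazyP G ^ i) u v ≠ 0) :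
    (lazyP G ^ k) u v ≠ 0 := by
  obtain ⟨j, rfl⟩ := Nat.exists_eq_add_of_le hik
  exact lazyP_pow_add_ne_zero G h (lazyP_pow_self_pos G j v).ne'

/-- The vertices that the lazy walk from `v` can occupy at time `k`. -/
noncomputable def reach (k : ℕ) (v : V) : Finset V :=
  Finset.univ.filter fun u => (lazyP G ^ k) v u ≠ 0

lemma mem_reach {k : ℕ} {u v : V} : u ∈ reach G k v ↔ (lazyP G ^ k) v u ≠ 0 := by
  simp [reach]

lemma mem_reach_self (k : ℕ) (v : V) : v ∈ reach G k v :=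
  (mem_reach G).2 (lazyP_pow_self_pos G k v).ne'

variable {G}
variable {d : ℕ}

/-- A walk has at most `d + 1` choices at each step. The Lipschitz constant in McDiarmid's
inequality comes from this bound. -/
lemma card_reach_le (hreg : G.IsRegularOfDegree d) (k : ℕ) (v : V) :
    (reach G k v).card ≤ (d + 1) ^ k := by
  induction k generalizing v with
  | zero =>
    rw [pow_zero, Finset.card_le_one]
    simp only [mem_reach, pow_zero, Matrix.one_apply]
    intro a ha b hb
    have h1 : v = a := by by_contra h; simp [h] at ha
    have h2 : v = b := by by_contra h; simp [h] at hb
    rw [← h1, h2]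
  | succ k ih =>
    have hsub : reach G (k + 1) v ⊆
        (reach G k v).biUnion fun w => insert w (G.neighborFinset w) := by
      intro u hu
      rw [mem_reach, pow_succ, Matrix.mul_apply] at hu
      obtain ⟨w, -, hw⟩ := Finset.exists_ne_zero_of_sum_ne_zero hu
      rw [Finset.mem_biUnion]
      refine ⟨w, (mem_reach G).2 (left_ne_zero_of_mul hw), ?_⟩
      have h2 := right_ne_zero_of_mul hw
      by_contra hcon
      simp only [Finset.mem_insert, SimpleGraph.mem_neighborFinset, not_or] at hcon
      simp [lazyP, hcon.1, hcon.2] at h2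
    calc (reach G (k + 1) v).card
        ≤ ((reach G k v).biUnion fun w => insert w (G.neighborFinset w)).card :=
          Finset.card_le_card hsub
      _ ≤ ∑ w ∈ reach G k v, (insert w (G.neighborFinset w)).card := Finset.card_biUnion_le
      _ ≤ ∑ w ∈ reach G k v, (d + 1) := by
          refine Finset.sum_le_sum fun w _ => (Finset.card_insert_le _ _).trans ?_
          rw [G.card_neighborFinset_eq_degree, hreg w]
      _ ≤ (d + 1) ^ (k + 1) := by
          rw [Finset.sum_const, smul_eq_mul, pow_succ]
          exact Nat.mul_le_mul_right _ (ih v)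

lemma lazyP_comm (hreg : G.IsRegularOfDegree d) (u v : V) : lazyP G u v = lazyP G v u := by
  unfold lazyP
  rw [hreg u, hreg v]
  simp only [G.adj_comm u v, eq_comm (a := v) (b := u)]

lemma lazyP_pow_comm (hreg : G.IsRegularOfDegree d) (k : ℕ) (u v : V) :
    (lazyP G ^ k) u v = (lazyP G ^ k) v u := by
  have hT : (lazyP G)ᵀ = lazyP G := by
    ext u v; rw [Matrix.transpose_apply, lazyP_comm hreg]
  rw [← Matrix.transpose_apply (lazyP G ^ k), Matrix.transpose_pow, hT]

lemma sum_lazyP_pow_left (hreg : G.IsRegularOfDegree d) (k : ℕ) (v : V) :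
    ∑ u, (lazyP G ^ k) u v = 1 := by
  rw [← sum_lazyP_pow G k v]
  exact Finset.sum_congr rfl fun u _ => lazyP_pow_comm hreg k u v

lemma mem_reach_comm (hreg : G.IsRegularOfDegree d) {k : ℕ} {u v : V} :
    u ∈ reach G k v ↔ v ∈ reach G k u := by
  rw [mem_reach, mem_reach, lazyP_pow_comm hreg]

/-- Follow one walk to the common place and the other one backwards. Meeting by time `t` is
therefore a local event, confined to distance `2 * t`. -/
lemma mem_reach_of_common (hreg : G.IsRegularOfDegree d) {i t : ℕ} (hi : i ≤ t) {u v a : V}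
    (hu : (lazyP G ^ i) u a ≠ 0) (hv : (lazyP G ^ i) v a ≠ 0) : u ∈ reach G (2 * t) v := by
  rw [mem_reach]
  refine lazyP_pow_ne_zero_of_le G (by omega : i + i ≤ 2 * t) ?_
  rw [lazyP_pow_comm hreg] at hu
  exact lazyP_pow_add_ne_zero G hv hu

/-- The Dirichlet form of the lazy walk. -/
lemma sum_lazyP_mul_sub_sq (hreg : G.IsRegularOfDegree d) (f : V → ℝ) :
    ∑ u, ∑ v, lazyP G u v * (f u - f v) ^ 2 =
      2 * ∑ u, f u ^ 2 - 2 * ∑ u, f u * (lazyP G *ᵥ f) u := by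
  have h1 : ∑ u, ∑ v, lazyP G u v * f u ^ 2 = ∑ u, f u ^ 2 :=
    Finset.sum_congr rfl fun u _ => by rw [← Finset.sum_mul, sum_lazyP, one_mul]
  have h2 : ∑ u, ∑ v, lazyP G u v * f v ^ 2 = ∑ u, f u ^ 2 := by
    rw [← h1, Finset.sum_comm]
    exact Finset.sum_congr rfl fun u _ => Finset.sum_congr rfl fun v _ => by
      rw [lazyP_comm hreg]
  have h3 : ∑ u, f u * (lazyP G *ᵥ f) u = ∑ u, ∑ v, lazyP G u v * (f u * f v) := by
    refine Finset.sum_congr rfl fun u _ => ?_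
    rw [Matrix.mulVec, dotProduct, Finset.mul_sum]
    exact Finset.sum_congr rfl fun v _ => by ring
  have h4 : ∀ u v, lazyP G u v * (f u - f v) ^ 2 = lazyP G u v * f u ^ 2 + lazyP G u v * f v ^ 2 -
      2 * (lazyP G u v * (f u * f v)) := fun u v => by ring
  simp only [h4, Finset.sum_sub_distrib, Finset.sum_add_distrib, ← Finset.mul_sum]
  rw [h1, h2, h3]; ring

/-- The lazy transition matrix is positive semidefinite. -/
lemma sum_mul_lazyP_mulVec_nonneg (hreg : G.IsRegularOfDegree d) (f : V → ℝ) :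
    0 ≤ ∑ u, f u * (lazyP G *ᵥ f) u := by
  have h := sum_lazyP_mul_sub_sq hreg f
  -- Only off-diagonal terms contribute, and there `(a - b) ^ 2 ≤ 2 * a ^ 2 + 2 * b ^ 2`. As the
  -- diagonal carries at least half of the mass, the Dirichlet form is at most `2 * ∑ u, f u ^ 2`.
  have h1 : ∑ u, ∑ v, lazyP G u v * (f u - f v) ^ 2 ≤
      ∑ u, ∑ v, if v = u then 0 else lazyP G u v * (2 * f u ^ 2 + 2 * f v ^ 2) := by
    refine Finset.sum_le_sum fun u _ => Finset.sum_le_sum fun v _ => ?_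
    split_ifs with huv
    · simp [huv]
    · exact mul_le_mul_of_nonneg_left (by nlinarith [sq_nonneg (f u + f v)]) (lazyP_nonneg G u v)
  have h2 : ∑ u, ∑ v, (if v = u then 0 else lazyP G u v * (2 * f u ^ 2 + 2 * f v ^ 2)) =
      ∑ u, ∑ v, lazyP G u v * (2 * f u ^ 2 + 2 * f v ^ 2) - ∑ u, lazyP G u u * (4 * f u ^ 2) := by
    rw [← Finset.sum_sub_distrib]
    refine Finset.sum_congr rfl fun u _ => ?_
    rw [eq_sub_iff_add_eq, ← Finset.sum_erase_add _ _ (Finset.mem_univ u),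
      ← Finset.sum_erase_add Finset.univ (fun v => lazyP G u v * (2 * f u ^ 2 + 2 * f v ^ 2))
        (Finset.mem_univ u), if_pos rfl,
      Finset.sum_congr rfl (fun v hv => if_neg (Finset.ne_of_mem_erase hv))]
    ring
  have h3 : ∑ u, ∑ v, lazyP G u v * (2 * f u ^ 2 + 2 * f v ^ 2) = 4 * ∑ u, f u ^ 2 := by
    have a1 : ∑ u, ∑ v, lazyP G u v * f u ^ 2 = ∑ u, f u ^ 2 :=
      Finset.sum_congr rfl fun u _ => by rw [← Finset.sum_mul, sum_lazyP, one_mul]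
    have a2 : ∑ u, ∑ v, lazyP G u v * f v ^ 2 = ∑ u, f u ^ 2 := by
      rw [← a1, Finset.sum_comm]
      exact Finset.sum_congr rfl fun u _ => Finset.sum_congr rfl fun v _ => by
        rw [lazyP_comm hreg]
    have a3 : ∀ u v, lazyP G u v * (2 * f u ^ 2 + 2 * f v ^ 2) =
      2 * (lazyP G u v * f u ^ 2) + 2 * (lazyP G u v * f v ^ 2) := fun u v => by ring
    simp only [a3, Finset.sum_add_distrib, ← Finset.mul_sum]
    rw [a1, a2]; ring
  have h4 : 2 * ∑ u, f u ^ 2 ≤ ∑ u, lazyP G u u * (4 * f u ^ 2) := by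
    rw [Finset.mul_sum]
    refine Finset.sum_le_sum fun u _ => ?_
    nlinarith [half_le_lazyP_self G u, sq_nonneg (f u)]
  linarith

/-- A function that is harmonic for the lazy walk on a connected regular graph is constant. -/
lemma eq_of_lazyP_mulVec_eq (hreg : G.IsRegularOfDegree d) (hconn : G.Connected) {f : V → ℝ}
    (hf : lazyP G *ᵥ f = f) (u v : V) : f u = f v := by
  have h := sum_lazyP_mul_sub_sq hreg f
  rw [hf] at h
  have h0 : ∑ u, ∑ v, lazyP G u v * (f u - f v) ^ 2 = 0 := by
    rw [h]; simp only [pow_two]; ring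
  have hnn : ∀ u v, 0 ≤ lazyP G u v * (f u - f v) ^ 2 := fun u v =>
    mul_nonneg (lazyP_nonneg G u v) (sq_nonneg _)
  have hadj : ∀ a b, G.Adj a b → f a = f b := by
    intro a b hab
    have h1 := (Finset.sum_eq_zero_iff_of_nonneg
      (fun u _ => Finset.sum_nonneg fun v _ => hnn u v)).1 h0 a (Finset.mem_univ a)
    have h2 := (Finset.sum_eq_zero_iff_of_nonneg (fun v _ => hnn a v)).1 h1 b (Finset.mem_univ b)
    have hpos : 0 < lazyP G a b := by
      have hd : 0 < G.degree a := (G.degree_pos_iff_exists_adj a).2 ⟨b, hab⟩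
      simp only [lazyP, hab.ne', if_false, hab, if_true]
      positivity
    have h3 := (mul_eq_zero.1 h2).resolve_left hpos.ne'
    linarith [pow_eq_zero_iff (two_ne_zero) |>.1 h3]
  obtain ⟨w⟩ := hconn.preconnected u v
  induction w with
  | nil => rfl
  | cons hab _ ih => exact (hadj _ _ hab).trans ih

variable {lam : ℝ}

/-- In an eigenbasis of `I - P`, every coordinate of a function of mean zero is zero or belongs to
an eigenvalue between `lam` and `1`. -/
lemma exists_eigenbasis (hreg : G.IsRegularOfDegree d) (hconn : G.Connected)
    (hexp : IsExpander G lam) :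
    ∃ (b : OrthonormalBasis V ℝ (EuclideanSpace ℝ V)) (μ : V → ℝ),
      (∀ i, lazyP G *ᵥ (b i).ofLp = (1 - μ i) • (b i).ofLp) ∧
      ∀ i, (∀ f : V → ℝ, ∑ v, f v = 0 → (b i).ofLp ⬝ᵥ f = 0) ∨ (lam ≤ μ i ∧ μ i ≤ 1) := by
  have hM : (1 - lazyP G).IsHermitian := by
    ext u v
    simp only [Matrix.conjTranspose_apply, Matrix.sub_apply, star_trivial, lazyP_comm hreg v u,
      Matrix.one_apply, eq_comm (a := v)]
  have heig : ∀ i, lazyP G *ᵥ (hM.eigenvectorBasis i).ofLp =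
      (1 - hM.eigenvalues i) • (hM.eigenvectorBasis i).ofLp := by
    intro i
    have := hM.mulVec_eigenvectorBasis i
    rw [Matrix.sub_mulVec, Matrix.one_mulVec, sub_eq_iff_eq_add] at this
    rw [sub_smul, one_smul, eq_sub_iff_add_eq, add_comm]
    exact this.symm
  have hsq : ∀ i, ∑ u, (hM.eigenvectorBasis i).ofLp u ^ 2 = 1 := by
    intro i
    have := EuclideanSpace.norm_sq_eq (hM.eigenvectorBasis i)
    rw [OrthonormalBasis.norm_eq_one] at this
    simpa using this.symm
  have hle : ∀ i, hM.eigenvalues i ≤ 1 := by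
    intro i
    have := sum_mul_lazyP_mulVec_nonneg hreg (hM.eigenvectorBasis i).ofLp
    rw [heig] at this
    have h2 : ∑ u, (hM.eigenvectorBasis i).ofLp u *
        ((1 - hM.eigenvalues i) • (hM.eigenvectorBasis i).ofLp) u =
        (1 - hM.eigenvalues i) * ∑ u, (hM.eigenvectorBasis i).ofLp u ^ 2 := by
      rw [Finset.mul_sum]
      exact Finset.sum_congr rfl fun u _ => by simp only [Pi.smul_apply, smul_eq_mul]; ring
    rw [h2, hsq] at this
    linarith
  refine ⟨hM.eigenvectorBasis, hM.eigenvalues, heig, fun i => ?_⟩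
  by_cases h0 : hM.eigenvalues i = 0
  -- An eigenvector of `I - P` for the eigenvalue `0` is harmonic, hence constant, hence orthogonal
  -- to functions of mean zero. The other eigenvalues are bounded below by the spectral gap.
  · left
    intro f hf
    have hc := eq_of_lazyP_mulVec_eq hreg hconn (f := (hM.eigenvectorBasis i).ofLp)
      (by rw [heig, h0, sub_zero, one_smul])
    rw [dotProduct, Finset.sum_congr rfl (fun v _ => by rw [hc v i]), ← Finset.mul_sum, hf,
      mul_zero]
  · right
    refine ⟨hexp.trans (csInf_le ?_ ⟨h0, ?_⟩), hle i⟩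
    · exact ((Module.End.finite_hasEigenvalue _).subset fun μ hμ => hμ.2).bddBelow
    · refine Module.End.hasEigenvalue_of_hasEigenvector
        (x := (hM.eigenvectorBasis i).ofLp) ⟨?_, ?_⟩
      · rw [Module.End.mem_eigenspace_iff, Matrix.toLin'_apply]
        exact hM.mulVec_eigenvectorBasis i
      · intro h
        have := hsq i
        simp [h] at this

/-- A difference of two point masses has mean zero and is not zero, so by Parseval some coordinate
in the eigenbasis is non-zero; its eigenvalue lies between `lam` and `1`. -/
lemma lam_le_one (hreg : G.IsRegularOfDegree d) (hconn : G.Connected) (hexp : IsExpander G lam)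
    (hcard : 2 ≤ Fintype.card V) : lam ≤ 1 := by
  obtain ⟨b, μ, -, h⟩ := exists_eigenbasis hreg hconn hexp
  obtain ⟨u, v, huv⟩ := Fintype.one_lt_card_iff.1 hcard
  set f : V → ℝ := Pi.single u 1 - Pi.single v 1 with hf
  have hf0 : ∑ w, f w = 0 := by simp [hf]
  by_contra hlam
  have hz : ∀ i, (b i).ofLp ⬝ᵥ f = 0 := by
    intro i
    rcases h i with h | h
    · exact h f hf0
    · exact absurd (h.1.trans h.2) hlam
  have hs := sum_sq_dotProduct_basis b f
  simp only [hz] at hs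
  have : f u ^ 2 ≤ ∑ w, f w ^ 2 :=
    Finset.single_le_sum (f := fun w => f w ^ 2) (fun w _ => sq_nonneg _) (Finset.mem_univ u)
  rw [← hs] at this
  simp [hf, huv] at this
  linarith

/-- Contraction of functions of mean zero under the lazy walk on an expander. -/
lemma sum_sq_lazyP_pow_mulVec_le (hreg : G.IsRegularOfDegree d) (hconn : G.Connected)
    (hexp : IsExpander G lam) (k : ℕ) {f : V → ℝ} (hf : ∑ v, f v = 0) :
    ∑ v, ((lazyP G ^ k) *ᵥ f) v ^ 2 ≤ ((1 - lam) ^ k) ^ 2 * ∑ v, f v ^ 2 := by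
  obtain ⟨b, μ, hb, h⟩ := exists_eigenbasis hreg hconn hexp
  have hT : (lazyP G)ᵀ = lazyP G := by
    ext u v; rw [Matrix.transpose_apply, lazyP_comm hreg]
  have step : ∀ i (g : V → ℝ), (b i).ofLp ⬝ᵥ (lazyP G *ᵥ g) = (1 - μ i) * ((b i).ofLp ⬝ᵥ g) := by
    intro i g
    rw [Matrix.dotProduct_mulVec, ← Matrix.mulVec_transpose, hT, hb, smul_dotProduct, smul_eq_mul]
  have hpow : ∀ i, (b i).ofLp ⬝ᵥ ((lazyP G ^ k) *ᵥ f) = (1 - μ i) ^ k * ((b i).ofLp ⬝ᵥ f) := by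
    intro i
    induction k with
    | zero => simp
    | succ k ih => rw [pow_succ', ← Matrix.mulVec_mulVec, step, ih]; ring
  rw [← sum_sq_dotProduct_basis b f, ← sum_sq_dotProduct_basis b (_ *ᵥ _), Finset.mul_sum]
  refine Finset.sum_le_sum fun i _ => ?_
  rw [hpow, mul_pow]
  rcases h i with h | h
  · rw [h f hf]; simp
  · have h1 : 0 ≤ 1 - μ i := by linarith
    have h2 : 1 - μ i ≤ 1 - lam := by linarith
    gcongr

/-- Constants are fixed by the walk, and subtracting the mean does not increase the sum of squares.
-/
lemma sum_sq_lazyP_pow_mulVec_sub_mean_le (hreg : G.IsRegularOfDegree d) (hconn : G.Connected)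
    (hexp : IsExpander G lam) (k : ℕ) (f : V → ℝ) :
    ∑ v, (((lazyP G ^ k) *ᵥ f) v - (∑ v, f v) / Fintype.card V) ^ 2 ≤
      ((1 - lam) ^ k) ^ 2 * ∑ v, f v ^ 2 := by
  have := hconn.nonempty
  have hn : (Fintype.card V : ℝ) ≠ 0 := by exact_mod_cast Fintype.card_ne_zero
  set m := (∑ v, f v) / Fintype.card V with hm
  have hsum : ∑ v, (f v - m) = 0 := by
    rw [Finset.sum_sub_distrib, Finset.sum_const, Finset.card_univ, nsmul_eq_mul, hm]
    field_simp; ring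
  have h1 := sum_sq_lazyP_pow_mulVec_le hreg hconn hexp k hsum
  have h2 : ∀ v, ((lazyP G ^ k) *ᵥ fun v => f v - m) v = ((lazyP G ^ k) *ᵥ f) v - m := by
    intro v
    simp only [Matrix.mulVec, dotProduct, mul_sub, Finset.sum_sub_distrib, ← Finset.sum_mul,
      sum_lazyP_pow, one_mul]
  simp only [h2] at h1
  refine h1.trans (mul_le_mul_of_nonneg_left ?_ (sq_nonneg _))
  have h3 : ∑ v, (f v - m) ^ 2 = ∑ v, f v ^ 2 - Fintype.card V * m ^ 2 := by
    have : ∀ v, (f v - m) ^ 2 = f v ^ 2 - 2 * m * f v + m ^ 2 := fun v => by ring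
    simp only [this, Finset.sum_add_distrib, Finset.sum_sub_distrib, ← Finset.mul_sum,
      Finset.sum_const, Finset.card_univ, nsmul_eq_mul]
    have : ∑ v, f v = Fintype.card V * m := by rw [hm]; field_simp
    rw [this]; ring
  rw [h3]
  have : 0 ≤ (Fintype.card V : ℝ) * m ^ 2 := by positivity
  linarith

/-- Contraction applied to a point mass at `y` and read off at the single vertex `x`. -/
lemma lazyP_pow_apply_le (hreg : G.IsRegularOfDegree d) (hconn : G.Connected)
    (hexp : IsExpander G lam) (hlam : lam ≤ 1) (k : ℕ) (x y : V) :
    (lazyP G ^ k) x y ≤ 1 / Fintype.card V + (1 - lam) ^ k := by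
  have h := sum_sq_lazyP_pow_mulVec_sub_mean_le hreg hconn hexp k (Pi.single y 1)
  have h1 : ∑ v, (Pi.single y 1 : V → ℝ) v = 1 := by simp
  have h2 : ∑ v, (Pi.single y 1 : V → ℝ) v ^ 2 = 1 := by simp [Pi.single_apply]
  rw [h1, h2, mul_one] at h
  have h3 : (((lazyP G ^ k) *ᵥ Pi.single y 1) x - 1 / Fintype.card V) ^ 2 ≤ ((1 - lam) ^ k) ^ 2 :=
    (Finset.single_le_sum (f := fun v =>
      (((lazyP G ^ k) *ᵥ Pi.single y 1) v - 1 / (Fintype.card V : ℝ)) ^ 2)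
      (fun w _ => sq_nonneg _) (Finset.mem_univ x)).trans h
  have h4 := abs_le_of_sq_le_sq h3 (pow_nonneg (by linarith) k)
  rw [Matrix.mulVec_single_one] at h4
  have := (abs_le.1 h4).2
  simp only [Matrix.col_apply] at this
  linarith

end Spectral

/-! ### The trajectory measure and its finite-dimensional laws -/

section WalkLaw

variable {V : Type*} [Fintype V] [DecidableEq V] [MeasurableSpace V] [DiscreteMeasurableSpace V]
  (G : SimpleGraph V) [DecidableRel G.Adj]

lemma lazyKernel_apply_singleton (u v : V) :
    lazyKernel G u {v} = ENNReal.ofReal (lazyP G u v) := by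
  change (lazyStep G u).toMeasure {v} = _
  rw [PMF.toMeasure_apply_singleton _ _ (MeasurableSet.singleton v)]
  rfl

lemma walkLaw_start (v : V) : (walkLaw G v).real {x | x 0 = v} = 1 := by
  have h : (walkLaw G v).map (Preorder.frestrictLe (π := fun _ => V) 0) =
      Measure.dirac (fun _ => v) := by
    rw [walkLaw, Kernel.traj_map_frestrictLe_apply, Kernel.partialTraj_self, Kernel.id_apply]
  have h2 : {x : ℕ → V | x 0 = v} = Preorder.frestrictLe (π := fun _ => V) 0 ⁻¹'
      {a | a ⟨0, Finset.mem_Iic.2 le_rfl⟩ = v} := rfl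
  have hm : MeasurableSet {a : Finset.Iic 0 → V | a ⟨0, Finset.mem_Iic.2 le_rfl⟩ = v} :=
    (Set.toFinite _).measurableSet
  rw [h2, ← map_measureReal_apply (Preorder.measurable_frestrictLe 0) hm, h, measureReal_def,
    Measure.dirac_apply' _ hm]
  simp

/-- The Markov property for one step. -/
lemma walkLaw_step (v : V) (k : ℕ) (B : Set (Finset.Iic k → V)) (y : V) :
    (walkLaw G v).real {x | Preorder.frestrictLe (π := fun _ => V) k x ∈ B ∧ x (k + 1) = y} =
      ∑ z, (walkLaw G v).real {x | Preorder.frestrictLe (π := fun _ => V) k x ∈ B ∧ x k = z} *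
        lazyP G z y := by
  have hB : ∀ B : Set (Finset.Iic k → V), MeasurableSet B := fun B => (Set.toFinite B).measurableSet
  set κ : (n : ℕ) → Kernel (Finset.Iic n → V) V := fun k => (lazyKernel G).comap
      (fun x : (i : Finset.Iic k) → V => x ⟨k, Finset.mem_Iic.2 le_rfl⟩)
      (measurable_pi_apply _) with hκ
  have h := Kernel.partialTraj_compProd_eq_map_traj (X := fun _ => V) (κ := κ) (Nat.zero_le k)
    (x₀ := fun _ => v)
  have hproj : Measurable fun a : Finset.Iic k → V => a ⟨k, Finset.mem_Iic.2 le_rfl⟩ :=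
    measurable_pi_apply _
  have h1 : walkLaw G v {x | Preorder.frestrictLe (π := fun _ => V) k x ∈ B ∧ x (k + 1) = y} =
      ∑ z, walkLaw G v {x | Preorder.frestrictLe (π := fun _ => V) k x ∈ B ∧ x k = z} *
        ENNReal.ofReal (lazyP G z y) := by
    have e1 : walkLaw G v {x | Preorder.frestrictLe (π := fun _ => V) k x ∈ B ∧ x (k + 1) = y} =
        (Kernel.partialTraj (X := fun _ => V) κ 0 k (fun _ => v) ⊗ₘ κ k) (B ×ˢ {y}) := by
      rw [h, Measure.map_apply (by fun_prop) ((hB B).prod (MeasurableSet.singleton y))]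
      rfl
    have e2 : ∀ z, walkLaw G v {x | Preorder.frestrictLe (π := fun _ => V) k x ∈ B ∧ x k = z} =
        Kernel.partialTraj (X := fun _ => V) κ 0 k (fun _ => v)
          (B ∩ {a | a ⟨k, Finset.mem_Iic.2 le_rfl⟩ = z}) := by
      intro z
      rw [← Kernel.traj_map_frestrictLe_apply,
        Measure.map_apply (Preorder.measurable_frestrictLe k) (hB _)]
      rfl
    rw [e1, Measure.compProd_apply_prod (hB B) (MeasurableSet.singleton y)]
    have e3 : ∀ a : Finset.Iic k → V, κ k a {y} =
        (fun z => ENNReal.ofReal (lazyP G z y)) (a ⟨k, Finset.mem_Iic.2 le_rfl⟩) := by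
      intro a
      rw [hκ, Kernel.comap_apply, lazyKernel_apply_singleton]
    simp only [e3, e2]
    rw [← lintegral_map (f := fun z => ENNReal.ofReal (lazyP G z y)) Measurable.of_discrete hproj,
      lintegral_fintype]
    refine Finset.sum_congr rfl fun z _ => ?_
    rw [mul_comm, Measure.map_apply hproj (MeasurableSet.singleton z),
      Measure.restrict_apply (hB _), Set.inter_comm]
    rfl
  rw [measureReal_def, h1, ENNReal.toReal_sum
    (fun z _ => ENNReal.mul_ne_top (measure_ne_top _ _) ENNReal.ofReal_ne_top)]
  refine Finset.sum_congr rfl fun z _ => ?_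
  rw [ENNReal.toReal_mul, ENNReal.toReal_ofReal (lazyP_nonneg G z y)]
  rfl

/-- The Markov property for several steps. -/
lemma walkLaw_steps (v : V) (k r : ℕ) (B : Set (Finset.Iic k → V)) (y : V) :
    (walkLaw G v).real {x | Preorder.frestrictLe (π := fun _ => V) k x ∈ B ∧ x (k + r) = y} =
      ∑ z, (walkLaw G v).real {x | Preorder.frestrictLe (π := fun _ => V) k x ∈ B ∧ x k = z} *
        (lazyP G ^ r) z y := by
  induction r generalizing y with
  | zero => simp [Matrix.one_apply]
  | succ r ih =>
    have h := walkLaw_step G v (k + r)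
      {a | Preorder.frestrictLe₂ (π := fun _ => V) (Nat.le_add_right k r) a ∈ B} y
    have e : ∀ x : ℕ → V, Preorder.frestrictLe (π := fun _ => V) (k + r) x ∈
        {a | Preorder.frestrictLe₂ (π := fun _ => V) (Nat.le_add_right k r) a ∈ B} ↔
        Preorder.frestrictLe (π := fun _ => V) k x ∈ B := fun x => Iff.rfl
    simp only [e] at h
    rw [← add_assoc, h]
    simp only [ih, pow_succ, Matrix.mul_apply, Finset.sum_mul, Finset.mul_sum]
    rw [Finset.sum_comm]
    exact Finset.sum_congr rfl fun _ _ => Finset.sum_congr rfl fun _ _ => by ring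

lemma walkLaw_apply (v : V) (i : ℕ) (a : V) :
    (walkLaw G v).real {x | x i = a} = (lazyP G ^ i) v a := by
  have h := walkLaw_steps G v 0 i Set.univ a
  simp only [Set.mem_univ, true_and, zero_add] at h
  rw [h, Finset.sum_eq_single v, walkLaw_start, one_mul]
  · intro z _ hz
    have h1 : (walkLaw G v).real {x | x 0 = z} = 0 := by
      have hc := probReal_compl_eq_one_sub (μ := walkLaw G v) (s := {x | x 0 = v})
        ((MeasurableSet.singleton v).preimage (measurable_pi_apply 0))
      rw [walkLaw_start, sub_self] at hc
      refine le_antisymm (hc ▸ measureReal_mono ?_) measureReal_nonneg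
      intro x hx hx'
      exact hz (hx.symm.trans hx')
    rw [h1, zero_mul]
  · simp

lemma walkLaw_apply₂ (v : V) {i j : ℕ} (hij : i ≤ j) (a b : V) :
    (walkLaw G v).real {x | x i = a ∧ x j = b} = (lazyP G ^ i) v a * (lazyP G ^ (j - i)) a b := by
  obtain ⟨r, rfl⟩ := Nat.exists_eq_add_of_le hij
  have h := walkLaw_steps G v i r {c | c ⟨i, Finset.mem_Iic.2 le_rfl⟩ = a} b
  have e : ∀ x : ℕ → V, Preorder.frestrictLe (π := fun _ => V) i x ∈
      {c : Finset.Iic i → V | c ⟨i, Finset.mem_Iic.2 le_rfl⟩ = a} ↔ x i = a := fun x => Iff.rfl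
  simp only [e] at h
  rw [h, Finset.sum_eq_single a]
  · simp only [and_self, walkLaw_apply, Nat.add_sub_cancel_left]
  · intro z _ hz
    have : {x : ℕ → V | x i = a ∧ x i = z} = ∅ := by
      ext x; simp only [Set.mem_ofPred_eq, Set.mem_empty_iff_false, iff_false, not_and]
      exact fun h1 h2 => hz (h2.symm.trans h1)
    simp [this]
  · simp

/-- The probability that the walk from `v` follows `γ` up to time `t`. -/
noncomputable def pathWeight (t : ℕ) (v : V) (γ : Fin (t + 1) → V) : ℝ :=
  (walkLaw G v).real {x | ∀ i : Fin (t + 1), x i = γ i}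

lemma pathWeight_nonneg (t : ℕ) (v : V) (γ : Fin (t + 1) → V) : 0 ≤ pathWeight G t v γ :=
  measureReal_nonneg

/-- The bridge between finite sums over paths up to time `t` and the measure on infinite
trajectories. -/
lemma sum_pathWeight_filter (t : ℕ) (v : V) (S : (Fin (t + 1) → V) → Prop) [DecidablePred S] :
    ∑ γ, pathWeight G t v γ * (if S γ then 1 else 0) =
      (walkLaw G v).real {x | S fun i => x i} := by
  have hm : Measurable fun (x : ℕ → V) (i : Fin (t + 1)) => x i :=
    measurable_pi_lambda _ fun i => measurable_pi_apply _
  have h := sum_measureReal_preimage_singleton (μ := walkLaw G v) (Finset.univ.filter S)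
    (f := fun (x : ℕ → V) (i : Fin (t + 1)) => x i) (fun γ _ => hm (MeasurableSet.singleton γ))
  rw [Finset.coe_filter_univ] at h
  rw [← Finset.sum_filter_add_sum_filter_not Finset.univ S]
  rw [Finset.sum_congr rfl (g := fun γ => pathWeight G t v γ) (s₂ := Finset.univ.filter S)
      (fun γ hγ => by rw [if_pos (Finset.mem_filter.1 hγ).2, mul_one]),
    Finset.sum_eq_zero (s := Finset.univ.filter fun γ => ¬ S γ)
      (fun γ hγ => by rw [if_neg (Finset.mem_filter.1 hγ).2, mul_zero]), add_zero]
  refine Eq.trans (Finset.sum_congr rfl fun γ _ => ?_) h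
  rw [pathWeight]
  congr 1
  ext x
  simp [funext_iff]

lemma sum_pathWeight (t : ℕ) (v : V) : ∑ γ, pathWeight G t v γ = 1 := by
  have := sum_pathWeight_filter G t v (fun _ => True)
  simpa using this

lemma sum_pathWeight_apply (t : ℕ) (v : V) (i : Fin (t + 1)) (a : V) :
    ∑ γ, pathWeight G t v γ * (if γ i = a then 1 else 0) = (lazyP G ^ (i : ℕ)) v a := by
  rw [sum_pathWeight_filter G t v (fun γ => γ i = a), walkLaw_apply]

lemma sum_pathWeight_apply₂ (t : ℕ) (v : V) {i j : Fin (t + 1)} (hij : i ≤ j) (a b : V) :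
    ∑ γ, pathWeight G t v γ * (if γ i = a ∧ γ j = b then 1 else 0) =
      (lazyP G ^ (i : ℕ)) v a * (lazyP G ^ ((j : ℕ) - i)) a b := by
  rw [sum_pathWeight_filter G t v (fun γ => γ i = a ∧ γ j = b),
    walkLaw_apply₂ G v (by exact_mod_cast hij)]

lemma lazyP_pow_ne_zero_of_pathWeight {t : ℕ} {v : V} {γ : Fin (t + 1) → V}
    (h : pathWeight G t v γ ≠ 0) (i : Fin (t + 1)) : (lazyP G ^ (i : ℕ)) v (γ i) ≠ 0 := by
  rw [← sum_pathWeight_apply G t v i]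
  refine (Finset.sum_pos' (fun γ' _ => mul_nonneg (pathWeight_nonneg G t v γ') ?_)
    ⟨γ, Finset.mem_univ γ, ?_⟩).ne'
  · split_ifs <;> norm_num
  · simpa using (pathWeight_nonneg G t v γ).lt_of_ne' h

/-- The joint law of the walk up to time `t` and of its position at time `t + r`. -/
lemma walkLaw_path_end (t r : ℕ) (v : V) (γ : Fin (t + 1) → V) (y : V) :
    (walkLaw G v).real {x | (∀ i : Fin (t + 1), x i = γ i) ∧ x (t + r) = y} =
      pathWeight G t v γ * (lazyP G ^ r) (γ (Fin.last t)) y := by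
  have h := walkLaw_steps G v t r
    {c | ∀ i : Fin (t + 1), c ⟨i, Finset.mem_Iic.2 (Nat.lt_succ_iff.1 i.2)⟩ = γ i} y
  have e : ∀ x : ℕ → V, Preorder.frestrictLe (π := fun _ => V) t x ∈
      {c : Finset.Iic t → V | ∀ i : Fin (t + 1),
        c ⟨i, Finset.mem_Iic.2 (Nat.lt_succ_iff.1 i.2)⟩ = γ i} ↔
      ∀ i : Fin (t + 1), x i = γ i := fun x => Iff.rfl
  simp only [e] at h
  rw [h, Finset.sum_eq_single (γ (Fin.last t))]
  · rw [pathWeight]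
    congr 2
    ext x
    simp only [Set.mem_ofPred_eq, and_iff_left_iff_imp]
    intro hx
    simpa using hx (Fin.last t)
  · intro z _ hz
    have : {x : ℕ → V | (∀ i : Fin (t + 1), x i = γ i) ∧ x t = z} = ∅ := by
      ext x; simp only [Set.mem_ofPred_eq, Set.mem_empty_iff_false, iff_false, not_and]
      intro hx h2
      have := hx (Fin.last t)
      simp only [Fin.val_last] at this
      exact hz (h2.symm.trans this)
    simp [this]
  · simp

end WalkLaw

/-! ### Balanced splittings of a partition -/

section Combinatorics

/-- If all classes of a partition are small, some union of classes and its complement are both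
large. -/
lemma exists_balanced_union {V C : Type*} [DecidableEq C] (S : Finset V) (π : V → C) (m : ℝ)
    (hm : 0 < m) (hsmall : ∀ c, ((S.filter fun v => π v = c).card : ℝ) < m)
    (hS : 3 * m ≤ S.card) :
    ∃ D : Finset C, m ≤ (S.filter fun v => π v ∈ D).card ∧
      m ≤ (S.filter fun v => π v ∉ D).card := by
  classical
  -- Take the fewest classes with total at least `m`. Removing one of them leaves less than `m`, and
  -- that one has less than `m`, so the union is below `2 * m` and the complement keeps more than
  -- `m`.
  have hex : ∃ k : ℕ, ∃ D : Finset C, D.card = k ∧ m ≤ (S.filter fun v => π v ∈ D).card := by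
    refine ⟨_, S.image π, rfl, ?_⟩
    rw [Finset.filter_true_of_mem fun v hv => Finset.mem_image_of_mem π hv]
    linarith
  obtain ⟨D, hD, hDm⟩ := Nat.find_spec hex
  refine ⟨D, hDm, ?_⟩
  have hne : D.Nonempty := by
    rw [Finset.nonempty_iff_ne_empty]
    rintro rfl
    simp at hDm
    linarith
  obtain ⟨c, hc⟩ := hne
  have hlt : ((S.filter fun v => π v ∈ D.erase c).card : ℝ) < m := by
    by_contra hcon
    refine Nat.find_min hex (m := (D.erase c).card) ?_ ⟨D.erase c, rfl, not_lt.1 hcon⟩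
    rw [← hD]
    exact Finset.card_erase_lt_of_mem hc
  have hsub : (S.filter fun v => π v ∈ D).card ≤
      (S.filter fun v => π v ∈ D.erase c).card + (S.filter fun v => π v = c).card := by
    refine (Finset.card_le_card fun v hv => ?_).trans (Finset.card_union_le _ _)
    simp only [Finset.mem_filter, Finset.mem_union, Finset.mem_erase] at hv ⊢
    by_cases h : π v = c
    · exact Or.inr ⟨hv.1, h⟩
    · exact Or.inl ⟨hv.1, h, hv.2⟩
  have hsum := Finset.card_filter_add_card_filter_not (s := S) (fun v => π v ∈ D)
  have h1 : ((S.filter fun v => π v ∈ D).card : ℝ) + (S.filter fun v => π v ∉ D).card = S.card := by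
    exact_mod_cast hsum
  have h2 : ((S.filter fun v => π v ∈ D).card : ℝ) ≤
      (S.filter fun v => π v ∈ D.erase c).card + (S.filter fun v => π v = c).card := by
    exact_mod_cast hsub
  linarith [hsmall c]

end Combinatorics

/-! ### Sprinkling: large spread-out sets of walkers meet after mixing -/

section Mixing

open Matrix

variable {V : Type*} [Fintype V] [DecidableEq V] {G : SimpleGraph V} [DecidableRel G.Adj]
  {d : ℕ} {lam : ℝ}

lemma isWeight_lazyP_pow (r : ℕ) (z : V → V) : IsWeight fun v y => (lazyP G ^ r) (z v) y :=
  ⟨fun v y => lazyP_pow_nonneg G r (z v) y, fun v => sum_lazyP_pow G r (z v)⟩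

/-- Many well spread walkers are, after mixing, expected to cover most vertices. -/
lemma card_filter_sum_lazyP_pow_lt (hreg : G.IsRegularOfDegree d) (hconn : G.Connected)
    (hexp : IsExpander G lam) (r : ℕ) (z : V → V) (A : Finset V) (R : ℝ)
    (hA : (Fintype.card V : ℝ) / 6 ≤ A.card)
    (hR : ∀ a, ((A.filter fun v => z v = a).card : ℝ) ≤ R)
    (hmix : ((1 - lam) ^ r) ^ 2 * R * 576 ≤ 1) :
    ((Finset.univ.filter fun x => ∑ v ∈ A, (lazyP G ^ r) (z v) x < 1 / 12).card : ℝ) ≤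
      Fintype.card V / 4 := by
  have := hconn.nonempty
  have hn : (0 : ℝ) < Fintype.card V := by exact_mod_cast Fintype.card_pos
  -- The occupation numbers of the walkers in `A`. Since `P ^ r` is symmetric, `P ^ r *ᵥ f` gives
  -- the expected occupation after `r` more steps.
  set f : V → ℝ := fun a => ((A.filter fun v => z v = a).card : ℝ) with hf
  have hsum : ∑ a, f a = A.card := by
    rw [hf, ← Nat.cast_sum]
    congr 1
    exact (Finset.card_eq_sum_card_fiberwise (fun v _ => Finset.mem_coe.2 (Finset.mem_univ _))).symm
  have hmul : ∀ x, ((lazyP G ^ r) *ᵥ f) x = ∑ v ∈ A, (lazyP G ^ r) (z v) x := by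
    intro x
    have h1 : ∀ a, (lazyP G ^ r) x a * f a =
        ∑ v ∈ A, if z v = a then (lazyP G ^ r) x a else 0 := by
      intro a
      rw [← Finset.sum_filter, Finset.sum_const, nsmul_eq_mul, mul_comm]
    simp only [Matrix.mulVec, dotProduct, h1]
    rw [Finset.sum_comm]
    refine Finset.sum_congr rfl fun v _ => ?_
    rw [Finset.sum_ite_eq, if_pos (Finset.mem_univ _), lazyP_pow_comm hreg]
  have hsq : ∑ a, f a ^ 2 ≤ R * Fintype.card V := by
    calc ∑ a, f a ^ 2 ≤ ∑ a, R * f a := by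
          refine Finset.sum_le_sum fun a _ => ?_
          rw [pow_two]
          exact mul_le_mul_of_nonneg_right (hR a) (Nat.cast_nonneg _)
      _ = R * A.card := by rw [← Finset.mul_sum, hsum]
      _ ≤ R * Fintype.card V := by
          have hR0 : 0 ≤ R := (Nat.cast_nonneg _).trans (hR (Classical.arbitrary V))
          exact mul_le_mul_of_nonneg_left (by exact_mod_cast Finset.card_le_univ A) hR0
  have hmain := sum_sq_lazyP_pow_mulVec_sub_mean_le hreg hconn hexp r f
  simp only [hmul, hsum] at hmain
  set W := Finset.univ.filter fun x => ∑ v ∈ A, (lazyP G ^ r) (z v) x < 1 / 12 with hW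
  -- Chebyshev: the average occupation is at least `1/6`, so each vertex of `W` contributes at least
  -- `1/144` to the squared deviation. The total is at most `n/576`, whence `W.card ≤ n/4`.
  have hmean : 1 / 6 ≤ (A.card : ℝ) / Fintype.card V := by
    rw [le_div_iff₀ hn]; linarith
  have hlow : (W.card : ℝ) * (1 / 144) ≤
      ∑ x, (∑ v ∈ A, (lazyP G ^ r) (z v) x - (A.card : ℝ) / Fintype.card V) ^ 2 := by
    calc (W.card : ℝ) * (1 / 144) = ∑ _x ∈ W, (1 / 144 : ℝ) := by
          rw [Finset.sum_const, nsmul_eq_mul]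
      _ ≤ ∑ x ∈ W, (∑ v ∈ A, (lazyP G ^ r) (z v) x - (A.card : ℝ) / Fintype.card V) ^ 2 := by
          refine Finset.sum_le_sum fun x hx => ?_
          have h := (Finset.mem_filter.1 hx).2
          nlinarith
      _ ≤ _ := Finset.sum_le_sum_of_subset_of_nonneg (Finset.subset_univ _)
          fun x _ _ => sq_nonneg _
  have hup : ((1 - lam) ^ r) ^ 2 * ∑ a, f a ^ 2 ≤ Fintype.card V / 576 := by
    calc ((1 - lam) ^ r) ^ 2 * ∑ a, f a ^ 2
        ≤ ((1 - lam) ^ r) ^ 2 * (R * Fintype.card V) :=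
          mul_le_mul_of_nonneg_left hsq (sq_nonneg _)
      _ = (((1 - lam) ^ r) ^ 2 * R * 576) * (Fintype.card V / 576) := by ring
      _ ≤ 1 * (Fintype.card V / 576) := mul_le_mul_of_nonneg_right hmix (by positivity)
      _ = _ := one_mul _
  linarith

lemma one_sub_le_exp_neg_sum {ι : Type*} (s : Finset ι) (q : ι → ℝ) (hq : ∀ i ∈ s, q i ≤ 1) :
    ∏ i ∈ s, (1 - q i) ≤ Real.exp (-∑ i ∈ s, q i) := by
  rw [← Finset.sum_neg_distrib, Real.exp_sum]
  exact Finset.prod_le_prod (fun i hi => sub_nonneg.2 (hq i hi))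
    fun i _ => Real.one_sub_le_exp_neg (q i)

/-- Two large, well spread sets of walkers that perform independent walks up to the mixing time are
unlikely not to meet. -/
lemma prodExp_forall_ne_le (hreg : G.IsRegularOfDegree d) (hconn : G.Connected)
    (hexp : IsExpander G lam) (r : ℕ) (z : V → V) (A B : Finset V) (hAB : Disjoint A B) (R : ℝ)
    (hA : (Fintype.card V : ℝ) / 6 ≤ A.card) (hB : (Fintype.card V : ℝ) / 6 ≤ B.card)
    (hRA : ∀ a, ((A.filter fun v => z v = a).card : ℝ) ≤ R)
    (hRB : ∀ a, ((B.filter fun v => z v = a).card : ℝ) ≤ R)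
    (hmix : ((1 - lam) ^ r) ^ 2 * R * 576 ≤ 1) :
    prodExp (fun v y => (lazyP G ^ r) (z v) y)
      (fun y => if ∀ u ∈ A, ∀ v ∈ B, y u ≠ y v then 1 else 0) ≤
      Real.exp (-(Fintype.card V / 1400)) := by
  classical
  set n : ℝ := (Fintype.card V : ℝ) with hn
  have hn0 : 0 ≤ n := Nat.cast_nonneg _
  set p : V → V → ℝ := fun v y => (lazyP G ^ r) (z v) y with hp
  have hw : IsWeight p := isWeight_lazyP_pow r z
  have hple : ∀ v x, p v x ≤ 1 := fun v x => by
    rw [← hw.sum_eq_one v]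
    exact Finset.single_le_sum (fun y _ => hw.nonneg v y) (Finset.mem_univ x)
  set U := Finset.univ.filter fun x => 1 / 12 ≤ ∑ v ∈ A, p v x ∧ 1 / 12 ≤ ∑ v ∈ B, p v x with hU
  have hUcard : n / 2 ≤ U.card := by
    have h1 := card_filter_sum_lazyP_pow_lt hreg hconn hexp r z A R hA hRA hmix
    have h2 := card_filter_sum_lazyP_pow_lt hreg hconn hexp r z B R hB hRB hmix
    have h3 : (Finset.univ : Finset V).card ≤ U.card +
        ((Finset.univ.filter fun x => ∑ v ∈ A, p v x < 1 / 12).card +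
          (Finset.univ.filter fun x => ∑ v ∈ B, p v x < 1 / 12).card) := by
      refine (Finset.card_le_card fun x _ => ?_).trans ((Finset.card_union_le _ _).trans
        (Nat.add_le_add_left (Finset.card_union_le _ _) _))
      simp only [hU, Finset.mem_union, Finset.mem_filter, Finset.mem_univ, true_and]
      by_cases ha : ∑ v ∈ A, p v x < 1 / 12
      · exact Or.inr (Or.inl ha)
      · by_cases hb : ∑ v ∈ B, p v x < 1 / 12
        · exact Or.inr (Or.inr hb)
        · exact Or.inl ⟨not_lt.1 ha, not_lt.1 hb⟩
    have h4 : n ≤ U.card + ((Finset.univ.filter fun x => ∑ v ∈ A, p v x < 1 / 12).card +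
          (Finset.univ.filter fun x => ∑ v ∈ B, p v x < 1 / 12).card) := by
      rw [hn, ← Finset.card_univ]; exact_mod_cast h3
    linarith
  -- Given the positions of `A`, the walkers of `B` avoid them with probability at most `exp
  -- (-k/12)`, where `k` counts the vertices of `U` covered by `A`. The weaker factor `1/24` keeps
  -- the fluctuation term in McDiarmid's inequality below the mean: `1/624 - 1/1152 > 1/1400`.
  set F : (V → V) → ℝ := fun y => -(1 / 24) * ((A.image y ∩ U).card : ℝ) with hF
  have hstep1 : prodExp p (fun y => if ∀ u ∈ A, ∀ v ∈ B, y u ≠ y v then 1 else 0) ≤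
      prodExp p (fun y => Real.exp (F y)) := by
    calc prodExp p (fun y => if ∀ u ∈ A, ∀ v ∈ B, y u ≠ y v then 1 else 0)
        ≤ prodExp p (fun y => ∏ v ∈ B, if y v ∈ A.image y then (0 : ℝ) else 1) := by
          refine hw.prodExp_mono fun y => ?_
          split_ifs with h
          · rw [Finset.prod_eq_one]
            intro v hv
            rw [if_neg]
            intro hmem
            obtain ⟨u, hu, huv⟩ := Finset.mem_image.1 hmem
            exact h u hu v hv huv
          · exact Finset.prod_nonneg fun v _ => by split_ifs <;> norm_num
      _ = prodExp p (fun y => ∏ v ∈ B, ∑ ω, p v ω * if ω ∈ A.image y then (0 : ℝ) else 1) := by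
          refine hw.prodExp_prod_mem B (fun v ω y => if ω ∈ A.image y then (0 : ℝ) else 1) ?_
          intro v hv u ω y a
          have : A.image (Function.update y v ω) = A.image y :=
            Finset.image_congr fun w hw' => Function.update_of_ne
              (fun hwv : w = v => Finset.disjoint_left.1 hAB (Finset.mem_coe.1 hw') (hwv ▸ hv)) _ _
          rw [this]
      _ ≤ prodExp p (fun y => Real.exp (F y)) := by
          refine hw.prodExp_mono fun y => ?_
          have h1 : ∀ v, ∑ ω, p v ω * (if ω ∈ A.image y then (0 : ℝ) else 1) =
              1 - ∑ x ∈ A.image y, p v x := by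
            intro v
            have : ∀ ω, p v ω * (if ω ∈ A.image y then (0 : ℝ) else 1) =
                p v ω - if ω ∈ A.image y then p v ω else 0 := fun ω => by split_ifs <;> ring
            simp only [this, Finset.sum_sub_distrib, hw.sum_eq_one, Finset.sum_ite_mem,
              Finset.univ_inter]
          simp only [h1]
          refine (one_sub_le_exp_neg_sum B _ fun v _ => ?_).trans (Real.exp_le_exp.2 ?_)
          · rw [← hw.sum_eq_one v]
            exact Finset.sum_le_sum_of_subset_of_nonneg (Finset.subset_univ _)
              fun x _ _ => hw.nonneg v x
          · rw [Finset.sum_comm, hF]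
            have h2 : ((A.image y ∩ U).card : ℝ) * (1 / 12) ≤
                ∑ x ∈ A.image y, ∑ v ∈ B, p v x := by
              calc ((A.image y ∩ U).card : ℝ) * (1 / 12)
                  = ∑ x ∈ A.image y ∩ U, (1 / 12 : ℝ) := by rw [Finset.sum_const, nsmul_eq_mul]
                _ ≤ ∑ x ∈ A.image y ∩ U, ∑ v ∈ B, p v x := by
                    refine Finset.sum_le_sum fun x hx => ?_
                    exact (Finset.mem_filter.1 (Finset.mem_inter.1 hx).2).2.2
                _ ≤ _ := Finset.sum_le_sum_of_subset_of_nonneg Finset.inter_subset_left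
                    fun x _ _ => Finset.sum_nonneg fun v _ => hw.nonneg v x
            have h3 : (0 : ℝ) ≤ ((A.image y ∩ U).card : ℝ) := Nat.cast_nonneg _
            linarith
  have hmean : prodExp p F ≤ -(n / 624) := by
    -- From `exp (1/12) ≥ 13/12`, each vertex of `U` is covered with probability at least `1/13`.
    -- With `n/2 ≤ U.card` this gives mean coverage `n/26`, and `26 * 24 = 624`.
    have hcov : ∀ x ∈ U, 1 / 13 ≤ prodExp p (fun y => if x ∈ A.image y then (1 : ℝ) else 0) := by
      intro x hx
      have h1 : prodExp p (fun y => if x ∈ A.image y then (1 : ℝ) else 0) =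
          1 - ∏ v ∈ A, (1 - p v x) := by
        have e1 : ∀ y : V → V, (if x ∈ A.image y then (1 : ℝ) else 0) =
            1 - ∏ v ∈ A, if y v = x then (0 : ℝ) else 1 := by
          intro y
          split_ifs with h
          · obtain ⟨v, hv, hvx⟩ := Finset.mem_image.1 h
            rw [Finset.prod_eq_zero (f := fun v => if y v = x then (0 : ℝ) else 1) hv (if_pos hvx),
              sub_zero]
          · rw [Finset.prod_eq_one, sub_self]
            intro v hv
            rw [if_neg fun hvx => h (Finset.mem_image.2 ⟨v, hv, hvx⟩)]
        rw [prodExp_congr e1, prodExp_sub, hw.prodExp_const,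
          hw.prodExp_prod_mem A (fun _ ω _ => if ω = x then (0 : ℝ) else 1)
            (fun _ _ _ _ _ _ => rfl), hw.prodExp_const]
        congr 1
        refine Finset.prod_congr rfl fun v _ => ?_
        have : ∀ ω, p v ω * (if ω = x then (0 : ℝ) else 1) =
            p v ω - if ω = x then p v ω else 0 := fun ω => by split_ifs <;> ring
        simp only [this, Finset.sum_sub_distrib, hw.sum_eq_one, Finset.sum_ite_eq',
          Finset.mem_univ, if_true]
      have h2 := one_sub_le_exp_neg_sum A (fun v => p v x) fun v _ => hple v x
      have h3 : Real.exp (-∑ v ∈ A, p v x) ≤ 12 / 13 := by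
        have h4 : (1 : ℝ) / 12 ≤ ∑ v ∈ A, p v x := (Finset.mem_filter.1 hx).2.1
        have h5 : Real.exp (-∑ v ∈ A, p v x) ≤ Real.exp (-(1 / 12)) :=
          Real.exp_le_exp.2 (by linarith)
        refine h5.trans ?_
        rw [Real.exp_neg, inv_le_comm₀ (Real.exp_pos _) (by norm_num)]
        have := Real.add_one_le_exp (1 / 12 : ℝ)
        norm_num at this ⊢
        linarith
      rw [h1]; linarith
    have hcard : ∀ y : V → V, F y =
        -(1 / 24) * ∑ x ∈ U, if x ∈ A.image y then (1 : ℝ) else 0 := by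
      intro y
      rw [Finset.sum_boole, Finset.filter_mem_eq_inter, Finset.inter_comm]
    rw [prodExp_congr hcard, prodExp_mul_left, prodExp_sum]
    have := Finset.card_nsmul_le_sum U _ (1 / 13 : ℝ) hcov
    rw [nsmul_eq_mul] at this
    linarith
  have hdiff : ∀ (y : V → V) v ω, |F (Function.update y v ω) - F y| ≤ 1 / 24 := by
    have hle : ∀ (y : V → V) v ω, ((A.image (Function.update y v ω) ∩ U).card : ℝ) ≤
        (A.image y ∩ U).card + 1 := by
      intro y v ω
      have : A.image (Function.update y v ω) ∩ U ⊆ insert ω (A.image y ∩ U) := by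
        intro x hx
        obtain ⟨hx1, hx2⟩ := Finset.mem_inter.1 hx
        obtain ⟨u, hu, hux⟩ := Finset.mem_image.1 hx1
        by_cases huv : u = v
        · subst huv
          rw [Function.update_self] at hux
          exact hux ▸ Finset.mem_insert_self _ _
        · rw [Function.update_of_ne huv] at hux
          exact Finset.mem_insert_of_mem
            (Finset.mem_inter.2 ⟨Finset.mem_image.2 ⟨u, hu, hux⟩, hx2⟩)
      exact_mod_cast (Finset.card_le_card this).trans (Finset.card_insert_le _ _)
    intro y v ω
    have h1 := hle y v ω
    have h2 := hle (Function.update y v ω) v (y v)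
    rw [Function.update_idem, Function.update_eq_self] at h2
    simp only [hF]
    rw [abs_le]
    constructor <;> linarith
  have hmc := hw.prodExp_exp_sub_le F (fun _ => 1 / 24) hdiff
  have hEF : prodExp p (fun y => Real.exp (F y)) =
      Real.exp (prodExp p F) * prodExp p (fun y => Real.exp (F y - prodExp p F)) := by
    rw [← prodExp_mul_left]
    refine prodExp_congr fun y => ?_
    rw [← Real.exp_add]; ring_nf
  refine hstep1.trans ?_
  rw [hEF]
  refine (mul_le_mul_of_nonneg_left hmc (Real.exp_pos _).le).trans ?_
  rw [← Real.exp_add, Finset.sum_const, Finset.card_univ, nsmul_eq_mul, ← hn]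
  refine Real.exp_le_exp.2 ?_
  nlinarith

/-- Sprinkling: if at least half of the walkers are well spread and lie in large classes, then after
the mixing time there is a class of linear size. -/
lemma prodExp_forall_class_lt_le (hreg : G.IsRegularOfDegree d) (hconn : G.Connected)
    (hexp : IsExpander G lam) (r : ℕ) (z : V → V) (S : Finset V) (R : ℝ)
    (hR : ∀ a, ((S.filter fun v => z v = a).card : ℝ) ≤ R)
    (hmix : ((1 - lam) ^ r) ^ 2 * R * 576 ≤ 1) (hS : (Fintype.card V : ℝ) / 2 ≤ S.card)
    (r₁ : V → V → Prop) (r₂ : (V → V) → V → V → Prop)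
    (h₁ : ∀ v ∈ S, 2800 ≤ Nat.card {u // Quot.mk r₁ u = Quot.mk r₁ v})
    (h₂ : ∀ y u v, r₁ u v → r₂ y u v)
    (h₃ : ∀ y, ∀ u ∈ S, ∀ v ∈ S, y u = y v → r₂ y u v) [DecidablePred fun y =>
      ∀ v, (Nat.card {u // Quot.mk (r₂ y) u = Quot.mk (r₂ y) v} : ℝ) < Fintype.card V / 6] :
    prodExp (fun v y => (lazyP G ^ r) (z v) y)
      (fun y => if ∀ v, (Nat.card {u // Quot.mk (r₂ y) u = Quot.mk (r₂ y) v} : ℝ) <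
        Fintype.card V / 6 then 1 else 0) ≤ Real.exp (-(Fintype.card V / 2800)) := by
  classical
  have := hconn.nonempty
  have hn0 : (0 : ℝ) < Fintype.card V := by exact_mod_cast Fintype.card_pos
  have hw : IsWeight fun v y => (lazyP G ^ r) (z v) y := isWeight_lazyP_pow r z
  set I := S.image (Quot.mk r₁) with hI
  set A : Finset (Quot r₁) → Finset V := fun D => S.filter fun v => Quot.mk r₁ v ∈ D with hA
  -- The candidate splits are fixed before `y` is drawn, which permits a union bound over at most `2
  -- ^ I.card ≤ exp (n/2800)` of them.
  set J := I.powerset.filter fun D => (Fintype.card V : ℝ) / 6 ≤ (A D).card ∧ (Fintype.card V : ℝ) / 6 ≤ (S \ A D).card with hJ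
  have hIcard : (I.card : ℝ) ≤ (Fintype.card V : ℝ) / 2800 := by
    have h : I.card * 2800 ≤ Fintype.card V := by
      rw [← Finset.card_univ (α := V)]
      refine (Finset.card_nsmul_le_sum I
        (fun c => (Finset.univ.filter fun u => Quot.mk r₁ u = c).card) 2800 ?_).trans ?_
      · intro c hc
        obtain ⟨v, hv, rfl⟩ := Finset.mem_image.1 hc
        have := h₁ v hv
        rwa [Nat.card_eq_fintype_card, Fintype.card_subtype] at this
      · rw [← Finset.card_biUnion]
        · exact Finset.card_le_card (Finset.subset_univ _)
        · intro a _ b _ hab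
          rw [Function.onFun, Finset.disjoint_left]
          intro u hu hu'
          exact hab ((Finset.mem_filter.1 hu).2.symm.trans (Finset.mem_filter.1 hu').2)
    have : (I.card : ℝ) * 2800 ≤ Fintype.card V := by exact_mod_cast h
    linarith
  have hcover : ∀ y : V → V,
      (if ∀ v, (Nat.card {u // Quot.mk (r₂ y) u = Quot.mk (r₂ y) v} : ℝ) < (Fintype.card V : ℝ) / 6 then (1 : ℝ)
        else 0) ≤
      ∑ D ∈ J, if ∀ u ∈ A D, ∀ v ∈ S \ A D, y u ≠ y v then (1 : ℝ) else 0 := by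
    intro y
    have hnn : ∀ D ∈ J, (0 : ℝ) ≤ if ∀ u ∈ A D, ∀ v ∈ S \ A D, y u ≠ y v then (1 : ℝ) else 0 :=
      fun D _ => by split_ifs <;> norm_num
    split_ifs with hy
    -- Every `r₂ y`-class is a union of `r₁`-classes, so a balanced union of final classes is also a
    -- split along the old ones.
    · obtain ⟨E, hE1, hE2⟩ := exists_balanced_union S (Quot.mk (r₂ y)) ((Fintype.card V : ℝ) / 6) (by linarith)
        (by
          intro c
          obtain ⟨v, rfl⟩ := Quot.exists_rep c
          refine lt_of_le_of_lt ?_ (hy v)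
          rw [Nat.card_eq_fintype_card, Fintype.card_subtype]
          exact_mod_cast Finset.card_le_card (Finset.filter_subset_filter _ (Finset.subset_univ _)))
        (by linarith)
      set D := (S.filter fun v => Quot.mk (r₂ y) v ∈ E).image (Quot.mk r₁) with hD
      have hquot : ∀ u v, Quot.mk r₁ u = Quot.mk r₁ v → Quot.mk (r₂ y) u = Quot.mk (r₂ y) v :=
        fun u v huv => congrArg (Quot.map id (h₂ y)) huv
      have hAD : A D = S.filter fun v => Quot.mk (r₂ y) v ∈ E := by
        ext v
        simp only [hA, hD, Finset.mem_filter, Finset.mem_image]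
        constructor
        · rintro ⟨hv, u, ⟨-, hu⟩, huv⟩
          exact ⟨hv, hquot u v huv ▸ hu⟩
        · rintro ⟨hv, hvE⟩
          exact ⟨hv, v, ⟨hv, hvE⟩, rfl⟩
      have hSAD : S \ A D = S.filter fun v => Quot.mk (r₂ y) v ∉ E := by
        rw [hAD, ← Finset.filter_not]
      have hDJ : D ∈ J := by
        rw [hJ, Finset.mem_filter, Finset.mem_powerset]
        refine ⟨Finset.image_subset_image (Finset.filter_subset _ _), ?_, ?_⟩
        · rw [hAD]; exact hE1
        · rw [hSAD]; exact hE2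
      refine le_trans ?_ (Finset.single_le_sum hnn hDJ)
      rw [if_pos]
      intro u hu v hv huv
      rw [hAD, Finset.mem_filter] at hu
      rw [hSAD, Finset.mem_filter] at hv
      exact hv.2 (Quot.sound (h₃ y u hu.1 v hv.1 huv) ▸ hu.2)
    · exact Finset.sum_nonneg hnn
  have hsub : ∀ T ⊆ S, ∀ a, ((T.filter fun v => z v = a).card : ℝ) ≤ R := fun T hT a =>
    le_trans (by exact_mod_cast Finset.card_le_card (Finset.filter_subset_filter _ hT)) (hR a)
  refine (hw.prodExp_mono hcover).trans ?_
  calc prodExp (fun v y => (lazyP G ^ r) (z v) y) (fun y =>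
        ∑ D ∈ J, if ∀ u ∈ A D, ∀ v ∈ S \ A D, y u ≠ y v then (1 : ℝ) else 0)
      ≤ ∑ D ∈ J, Real.exp (-((Fintype.card V : ℝ) / 1400)) := by
        rw [prodExp_sum]
        refine Finset.sum_le_sum fun D hD => ?_
        rw [hJ, Finset.mem_filter] at hD
        exact prodExp_forall_ne_le hreg hconn hexp r z (A D) (S \ A D) Finset.disjoint_sdiff R
          hD.2.1 hD.2.2 (hsub _ (Finset.filter_subset _ _)) (hsub _ Finset.sdiff_subset) hmix
    _ ≤ Real.exp ((Fintype.card V : ℝ) / 2800) * Real.exp (-((Fintype.card V : ℝ) / 1400)) := by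
        rw [Finset.sum_const, nsmul_eq_mul]
        refine mul_le_mul_of_nonneg_right ?_ (Real.exp_pos _).le
        have h1 : J.card ≤ 2 ^ I.card := by
          rw [← Finset.card_powerset]; exact Finset.card_filter_le _ _
        calc (J.card : ℝ) ≤ 2 ^ I.card := by exact_mod_cast h1
          _ ≤ Real.exp 1 ^ I.card := by
              refine pow_le_pow_left₀ (by norm_num) ?_ _
              have := Real.add_one_le_exp (1 : ℝ); linarith
          _ = Real.exp I.card := by rw [← Real.exp_nat_mul, mul_one]
          _ ≤ Real.exp ((Fintype.card V : ℝ) / 2800) := Real.exp_le_exp.2 hIcard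
    _ = Real.exp (-((Fintype.card V : ℝ) / 2800)) := by rw [← Real.exp_add]; congr 1; ring

end Mixing

/-! ### Exponential moments and lower tails -/

section Concentration

variable {ι Ω : Type*} [Fintype ι] [DecidableEq ι] [Fintype Ω]

namespace IsWeight

variable {p : ι → Ω → ℝ}

/-- The exponential moment of the number of events that occur among independent ones, on the event
that a further coordinate takes a given value. -/
lemma prodExp_exp_card_le [DecidableEq Ω] (hp : IsWeight p) (v : ι) (ω₀ : Ω) (T : Finset ι)
    (hv : v ∉ T) (h : ι → Ω → Prop) [∀ u, DecidablePred (h u)] (τ : ℝ) :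
    prodExp p (fun x => (if x v = ω₀ then 1 else 0) *
        Real.exp (τ * (T.filter fun u => h u (x u)).card)) ≤
      p v ω₀ * Real.exp ((Real.exp τ - 1) *
        ∑ u ∈ T, ∑ ω, p u ω * (if h u ω then 1 else 0)) := by
  -- Treating the indicator at `v` as one more factor turns the integrand into a product; `1 + x ≤
  -- exp x` then bounds each factor over `T`.
  set g : ι → Ω → ℝ := fun u ω =>
    if u = v then (if ω = ω₀ then 1 else 0) else (if h u ω then Real.exp τ else 1) with hg
  have hne : ∀ u ∈ T, u ≠ v := fun u hu huv => hv (huv ▸ hu)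
  have e1 : ∀ x : ι → Ω, (if x v = ω₀ then (1 : ℝ) else 0) *
      Real.exp (τ * (T.filter fun u => h u (x u)).card) = ∏ u ∈ insert v T, g u (x u) := by
    intro x
    rw [Finset.prod_insert hv]
    congr 1
    · simp [hg]
    · rw [Finset.prod_congr rfl (g := fun u => if h u (x u) then Real.exp τ else 1)
        (fun u hu => by simp only [hg, if_neg (hne u hu)]), ← Finset.prod_filter,
        Finset.prod_const, mul_comm, Real.exp_nat_mul]
  rw [prodExp_congr e1, hp.prodExp_prod_mem (insert v T) (fun u ω _ => g u ω)
    (fun _ _ _ _ _ _ => rfl), hp.prodExp_const, Finset.prod_insert hv]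
  have e2 : ∑ ω, p v ω * g v ω = p v ω₀ := by simp [hg]
  rw [e2]
  refine mul_le_mul_of_nonneg_left ?_ (hp.nonneg v ω₀)
  rw [Finset.mul_sum, Real.exp_sum]
  refine Finset.prod_le_prod (fun u hu => Finset.sum_nonneg fun ω _ =>
    mul_nonneg (hp.nonneg u ω) ?_) fun u hu => ?_
  · simp only [hg, if_neg (hne u hu)]
    split_ifs <;> positivity
  · have e3 : ∀ ω, p u ω * g u ω =
        p u ω + (Real.exp τ - 1) * (p u ω * (if h u ω then 1 else 0)) := by
      intro ω
      simp only [hg, if_neg (hne u hu)]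
      split_ifs <;> ring
    simp only [e3, Finset.sum_add_distrib, hp.sum_eq_one, ← Finset.mul_sum]
    rw [add_comm]
    exact Real.add_one_le_exp _

/-- McDiarmid's inequality for the lower tail. -/
lemma prodExp_lt_le (hp : IsWeight p) (f : (ι → Ω) → ℝ) (L : ℝ) (hL : 0 < L)
    (hf : ∀ x v ω, |f (Function.update x v ω) - f x| ≤ L) (a δ : ℝ) (hδ : 0 ≤ δ)
    (hmean : a + δ * Fintype.card ι ≤ prodExp p f) [DecidablePred fun x => f x < a] :
    prodExp p (fun x => if f x < a then 1 else 0) ≤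
      Real.exp (-(δ ^ 2 / 2 * Fintype.card ι / L ^ 2)) := by
  -- The minimiser of `-θ * δ + θ ^ 2 * L ^ 2 / 2`.
  set θ := δ / L ^ 2 with hθ
  have hθ0 : 0 ≤ θ := by positivity
  have hmc := hp.prodExp_exp_sub_le (fun x => -θ * f x) (fun _ => θ * L) (by
    intro x v ω
    rw [← mul_sub, abs_mul, abs_neg, abs_of_nonneg hθ0]
    exact mul_le_mul_of_nonneg_left (hf x v ω) hθ0)
  rw [prodExp_mul_left] at hmc
  calc prodExp p (fun x => if f x < a then 1 else 0)
      ≤ prodExp p (fun x => Real.exp (θ * (a - prodExp p f)) *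
          Real.exp (-θ * f x - -θ * prodExp p f)) := by
        refine hp.prodExp_mono fun x => ?_
        rw [← Real.exp_add]
        split_ifs with h
        · rw [Real.one_le_exp_iff]
          have : 0 ≤ θ * (a - f x) := mul_nonneg hθ0 (by linarith)
          linarith
        · exact (Real.exp_pos _).le
    _ ≤ Real.exp (θ * (a - prodExp p f)) * Real.exp (∑ _v : ι, (θ * L) ^ 2 / 2) := by
        rw [prodExp_mul_left]
        exact mul_le_mul_of_nonneg_left hmc (Real.exp_pos _).le
    _ ≤ _ := by
        rw [← Real.exp_add, Finset.sum_const, Finset.card_univ, nsmul_eq_mul]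
        refine Real.exp_le_exp.2 ?_
        have h1 : θ * (a - prodExp p f) ≤ θ * -(δ * Fintype.card ι) :=
          mul_le_mul_of_nonneg_left (by linarith) hθ0
        have h2 : θ * -(δ * Fintype.card ι) + Fintype.card ι * ((θ * L) ^ 2 / 2) =
            -(δ ^ 2 / 2 * Fintype.card ι / L ^ 2) := by
          rw [hθ]; field_simp; ring
        linarith

end IsWeight

end Concentration

/-! ### Hitting a given trajectory: the second moment method -/

section Hitting

variable {V : Type*} [Fintype V] [DecidableEq V] {G : SimpleGraph V} [DecidableRel G.Adj]
  {d : ℕ} {lam : ℝ}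

/-- Each term is at most `1/n` plus a geometric term in the time lag. This bounds the expected
number of coincidences from time `i` on, given one at time `i`, uniformly in the trajectory `γ`. -/
lemma sum_fin_lazyP_pow_le (hreg : G.IsRegularOfDegree d) (hconn : G.Connected)
    (hexp : IsExpander G lam) (hlam0 : 0 < lam) (hlam : lam ≤ 1) {t : ℕ} (γ : Fin (t + 1) → V)
    (i : Fin (t + 1)) :
    ∑ j ∈ Finset.univ.filter (fun j => i ≤ j), (lazyP G ^ ((j : ℕ) - i)) (γ i) (γ j) ≤
      (t + 1) / Fintype.card V + 1 / lam := by
  have hinj : Set.InjOn (fun j : Fin (t + 1) => (j : ℕ) - i)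
      (Finset.univ.filter (fun j => i ≤ j)) := by
    intro j hj k hk hjk
    simp only [Finset.coe_filter, Finset.mem_univ, true_and, Set.mem_ofPred_eq] at hj hk hjk
    rw [Fin.le_def] at hj hk
    exact Fin.ext (by omega)
  calc ∑ j ∈ Finset.univ.filter (fun j => i ≤ j), (lazyP G ^ ((j : ℕ) - i)) (γ i) (γ j)
      ≤ ∑ j ∈ Finset.univ.filter (fun j => i ≤ j),
          (1 / (Fintype.card V : ℝ) + (1 - lam) ^ ((j : ℕ) - i)) :=
        Finset.sum_le_sum fun j _ => lazyP_pow_apply_le hreg hconn hexp hlam _ _ _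
    _ = ∑ k ∈ (Finset.univ.filter (fun j => i ≤ j)).image (fun j : Fin (t + 1) => (j : ℕ) - i),
          (1 / (Fintype.card V : ℝ) + (1 - lam) ^ k) := (Finset.sum_image
          (f := fun k => 1 / (Fintype.card V : ℝ) + (1 - lam) ^ k) hinj).symm
    _ ≤ ∑ k ∈ Finset.range (t + 1), (1 / (Fintype.card V : ℝ) + (1 - lam) ^ k) := by
        refine Finset.sum_le_sum_of_subset_of_nonneg ?_ fun k _ _ => ?_
        · intro k hk
          obtain ⟨j, -, rfl⟩ := Finset.mem_image.1 hk
          exact Finset.mem_range.2 (by omega)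
        · have : 0 ≤ 1 - lam := by linarith
          positivity
    _ ≤ (t + 1) / Fintype.card V + 1 / lam := by
        rw [Finset.sum_add_distrib, Finset.sum_const, Finset.card_range, nsmul_eq_mul]
        have hgeo : (∑ k ∈ Finset.range (t + 1), (1 - lam) ^ k) * lam = 1 - (1 - lam) ^ (t + 1) := by
          have := geom_sum_mul_neg (1 - lam) (t + 1)
          rwa [sub_sub_cancel] at this
        have hg : ∑ k ∈ Finset.range (t + 1), (1 - lam) ^ k ≤ 1 / lam := by
          rw [le_div_iff₀ hlam0, hgeo]
          have : 0 ≤ (1 - lam) ^ (t + 1) := pow_nonneg (by linarith) _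
          linarith
        push_cast
        have : ((t : ℝ) + 1) * (1 / Fintype.card V) = (t + 1) / Fintype.card V := by ring
        linarith

variable [MeasurableSpace V] [DiscreteMeasurableSpace V]

/-- Second moment bound for the probability that a walk meets a given trajectory. -/
lemma le_sum_pathWeight_hit (hreg : G.IsRegularOfDegree d) (hconn : G.Connected)
    (hexp : IsExpander G lam) (hlam0 : 0 < lam) (hlam : lam ≤ 1) {t : ℕ} (γ : Fin (t + 1) → V)
    (u : V) :
    (∑ i : Fin (t + 1), (lazyP G ^ (i : ℕ)) u (γ i)) / (2 * ((t + 1) / Fintype.card V + 1 / lam)) ≤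
      ∑ γ', pathWeight G t u γ' * (if ∃ i, γ i = γ' i then 1 else 0) := by
  set M := ((t : ℝ) + 1) / Fintype.card V + 1 / lam with hM
  have hM0 : 0 < M := by positivity
  set e := ∑ i : Fin (t + 1), (lazyP G ^ (i : ℕ)) u (γ i) with he
  set Z : (Fin (t + 1) → V) → ℝ := fun γ' => ∑ i, if γ' i = γ i then 1 else 0 with hZ
  have hEZ : ∑ γ', pathWeight G t u γ' * Z γ' = e := by
    simp only [hZ, Finset.mul_sum]
    rw [Finset.sum_comm]
    exact Finset.sum_congr rfl fun i _ => sum_pathWeight_apply G t u i (γ i)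
  -- Pairs of times are put in increasing order so that the Markov property applies; the diagonal is
  -- counted twice, which only loses a constant.
  have hZ2 : ∀ γ', Z γ' ^ 2 ≤
      2 * ∑ i, ∑ j ∈ Finset.univ.filter (fun j => i ≤ j),
        if γ' i = γ i ∧ γ' j = γ j then (1 : ℝ) else 0 := by
    intro γ'
    set c : Fin (t + 1) → Fin (t + 1) → ℝ := fun i j =>
      if γ' i = γ i ∧ γ' j = γ j then (1 : ℝ) else 0 with hc
    have h0 : ∀ i j, 0 ≤ c i j := fun i j => by simp only [hc]; split_ifs <;> norm_num
    have h1 : Z γ' ^ 2 = ∑ i, ∑ j, c i j := by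
      rw [hZ, pow_two, Finset.sum_mul_sum]
      refine Finset.sum_congr rfl fun i _ => Finset.sum_congr rfl fun j _ => ?_
      simp only [hc, ite_and]
      split_ifs <;> norm_num
    have h2 : ∑ i, ∑ j, c i j ≤ ∑ i, ∑ j, ((if i ≤ j then c i j else 0) +
        (if j ≤ i then c j i else 0)) := by
      refine Finset.sum_le_sum fun i _ => Finset.sum_le_sum fun j _ => ?_
      have hsym : c j i = c i j := by simp only [hc, and_comm]
      rw [hsym]
      have := h0 i j
      rcases le_total i j with h | h
      · rw [if_pos h]; split_ifs <;> linarith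
      · rw [if_pos h]; split_ifs <;> linarith
    have h3 : ∑ i, ∑ j, (if j ≤ i then c j i else 0) = ∑ i, ∑ j, (if i ≤ j then c i j else 0) :=
      Finset.sum_comm
    simp only [Finset.sum_add_distrib] at h2
    rw [h3] at h2
    rw [h1]
    simp only [Finset.sum_filter]
    linarith
  have hEZ2 : ∑ γ', pathWeight G t u γ' * Z γ' ^ 2 ≤ 2 * (e * M) := by
    calc ∑ γ', pathWeight G t u γ' * Z γ' ^ 2
        ≤ ∑ γ', pathWeight G t u γ' * (2 * ∑ i, ∑ j ∈ Finset.univ.filter (fun j => i ≤ j),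
            if γ' i = γ i ∧ γ' j = γ j then (1 : ℝ) else 0) :=
          Finset.sum_le_sum fun γ' _ =>
            mul_le_mul_of_nonneg_left (hZ2 γ') (pathWeight_nonneg G t u γ')
      _ = 2 * ∑ i, ∑ j ∈ Finset.univ.filter (fun j => i ≤ j),
            ∑ γ', pathWeight G t u γ' * if γ' i = γ i ∧ γ' j = γ j then (1 : ℝ) else 0 := by
          simp only [Finset.mul_sum]
          rw [Finset.sum_comm]
          refine Finset.sum_congr rfl fun i _ => ?_
          rw [Finset.sum_comm]
          exact Finset.sum_congr rfl fun j _ => Finset.sum_congr rfl fun γ' _ => by ring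
      _ = 2 * ∑ i : Fin (t + 1), (lazyP G ^ (i : ℕ)) u (γ i) * ∑ j ∈ Finset.univ.filter (fun j => i ≤ j),
            (lazyP G ^ ((j : ℕ) - i)) (γ i) (γ j) := by
          congr 1
          refine Finset.sum_congr rfl fun i _ => ?_
          rw [Finset.mul_sum]
          refine Finset.sum_congr rfl fun j hj => ?_
          exact sum_pathWeight_apply₂ G t u (Finset.mem_filter.1 hj).2 _ _
      _ ≤ 2 * (e * M) := by
          rw [he, Finset.sum_mul]
          refine mul_le_mul_of_nonneg_left (Finset.sum_le_sum fun i _ => ?_) (by norm_num)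
          exact mul_le_mul_of_nonneg_left
            (sum_fin_lazyP_pow_le hreg hconn hexp hlam0 hlam γ i) (lazyP_pow_nonneg G _ _ _)
  -- When there is a hit the left side is `1 - (1 - Z / (2 * M)) ^ 2`. Its expectation is at least
  -- `e / M - 2 * e * M / (4 * M ^ 2) = e / (2 * M)`.
  have hind : ∀ γ' : Fin (t + 1) → V,
      1 / M * Z γ' - 1 / (4 * M ^ 2) * Z γ' ^ 2 ≤ if ∃ i, γ i = γ' i then 1 else 0 := by
    intro γ'
    split_ifs with h
    · have h1 : 1 / M * Z γ' - 1 / (4 * M ^ 2) * Z γ' ^ 2 = 1 - (1 - Z γ' / (2 * M)) ^ 2 := by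
        field_simp; ring
      rw [h1]
      linarith [sq_nonneg (1 - Z γ' / (2 * M))]
    · have : Z γ' = 0 := by
        refine Finset.sum_eq_zero fun i _ => if_neg fun hi => h ⟨i, hi.symm⟩
      simp [this]
  calc e / (2 * M) = 1 / M * e - 1 / (4 * M ^ 2) * (2 * (e * M)) := by field_simp; ring
    _ ≤ 1 / M * ∑ γ', pathWeight G t u γ' * Z γ' -
          1 / (4 * M ^ 2) * ∑ γ', pathWeight G t u γ' * Z γ' ^ 2 := by
        rw [hEZ]
        have := mul_le_mul_of_nonneg_left hEZ2 (by positivity : 0 ≤ 1 / (4 * M ^ 2))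
        linarith
    _ = ∑ γ', pathWeight G t u γ' * (1 / M * Z γ' - 1 / (4 * M ^ 2) * Z γ' ^ 2) := by
        rw [Finset.mul_sum, Finset.mul_sum, ← Finset.sum_sub_distrib]
        exact Finset.sum_congr rfl fun γ' _ => by ring
    _ ≤ _ := Finset.sum_le_sum fun γ' _ =>
        mul_le_mul_of_nonneg_left (hind γ') (pathWeight_nonneg G t u γ')

/-- A given trajectory is met by many walks that start at other vertices. -/
lemma le_sum_sum_pathWeight_hit (hreg : G.IsRegularOfDegree d) (hconn : G.Connected)
    (hexp : IsExpander G lam) (hlam0 : 0 < lam) (hlam : lam ≤ 1) {t : ℕ} (γ : Fin (t + 1) → V)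
    (v : V) (hγ : pathWeight G t v γ ≠ 0) (hn : 40000 ≤ Fintype.card V)
    (ht : 40000 ≤ lam * (t + 1)) :
    9999 ≤ ∑ u ∈ (reach G (2 * t) v).erase v,
      ∑ γ', pathWeight G t u γ' * (if ∃ i, γ i = γ' i then 1 else 0) := by
  have := hconn.nonempty
  set M := ((t : ℝ) + 1) / Fintype.card V + 1 / lam with hM
  have hM0 : 0 < M := by positivity
  set hit : V → ℝ := fun u =>
    ∑ γ', pathWeight G t u γ' * (if ∃ i, γ i = γ' i then 1 else 0) with hhit
  have hMle : M * 20000 ≤ t + 1 := by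
    have h1 : ((t : ℝ) + 1) / Fintype.card V ≤ (t + 1) / 40000 := by
      refine div_le_div_of_nonneg_left (by positivity) (by norm_num) (by exact_mod_cast hn)
    have h2 : 1 / lam ≤ (t + 1) / 40000 := by
      rw [div_le_div_iff₀ hlam0 (by norm_num)]; linarith
    linarith
  have hv : hit v ≤ 1 := by
    rw [← sum_pathWeight G t v]
    refine Finset.sum_le_sum fun γ' _ => ?_
    refine mul_le_of_le_one_right (pathWeight_nonneg G t v γ') ?_
    split_ifs <;> norm_num
  -- Columns of `P ^ i` sum to one, so the total over all starting vertices is exactly `t + 1`, and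
  -- all of it comes from `reach G (2 * t) v`. Dividing by `2 * M` leaves `10000`; removing `v`
  -- itself costs at most `1`.
  have hall : ∑ u, ∑ i : Fin (t + 1), (lazyP G ^ (i : ℕ)) u (γ i) = t + 1 := by
    rw [Finset.sum_comm]
    simp only [sum_lazyP_pow_left hreg, Finset.sum_const, Finset.card_univ, Fintype.card_fin,
      nsmul_eq_mul, mul_one]
    push_cast; ring
  have hreach : ∑ u ∈ reach G (2 * t) v, ∑ i : Fin (t + 1), (lazyP G ^ (i : ℕ)) u (γ i) = t + 1 := by
    rw [← hall]
    refine Finset.sum_subset (Finset.subset_univ _) fun u _ hu => Finset.sum_eq_zero fun i _ => ?_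
    by_contra hne
    exact hu (mem_reach_of_common hreg (Nat.lt_succ_iff.1 i.2) hne
      (lazyP_pow_ne_zero_of_pathWeight G hγ i))
  have hsum : ((t : ℝ) + 1) / (2 * M) ≤ ∑ u ∈ reach G (2 * t) v, hit u := by
    rw [← hreach, Finset.sum_div]
    exact Finset.sum_le_sum fun u _ => le_sum_pathWeight_hit hreg hconn hexp hlam0 hlam γ u
  have h10 : 10000 ≤ ((t : ℝ) + 1) / (2 * M) := by
    rw [le_div_iff₀ (by positivity)]; linarith
  rw [← Finset.sum_erase_add _ _ (mem_reach_self G (2 * t) v)] at hsum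
  linarith

end Hitting

/-! ### Good vertices and the two-phase estimate -/

section Good

/-- A presence flag (is there at least one walker at the vertex?) together with the trajectory up to
time `t` of the first walker of the vertex. -/
abbrev Start (V : Type*) (t : ℕ) : Type _ := Bool × (Fin (t + 1) → V)

/-- The walkers of two vertices exist and meet by time `t` or at the final time. -/
def WalkersMeet {V : Type*} {t : ℕ} (ξ : V → Start V t) (y : V → V) (u v : V) : Prop :=
  (ξ u).1 = true ∧ (ξ v).1 = true ∧ ((∃ i, (ξ u).2 i = (ξ v).2 i) ∨ y u = y v)

variable {V : Type*} [Fintype V] [DecidableEq V]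

section Measurable

variable [MeasurableSpace V] [DiscreteMeasurableSpace V] (G : SimpleGraph V) [DecidableRel G.Adj]
  (t : ℕ)

/-- The law of `Start V t` at a vertex whose number of walkers is Poisson of mean one. -/
noncomputable def startWeight (v : V) (ω : Start V t) : ℝ :=
  (if ω.1 = true then 1 - Real.exp (-1) else Real.exp (-1)) * pathWeight G t v ω.2

lemma exp_neg_one_le : Real.exp (-1) ≤ 37 / 100 := by
  have := Real.exp_neg_one_lt_d9
  norm_num at this ⊢
  linarith

lemma isWeight_startWeight : IsWeight (startWeight G t) where
  nonneg v ω := by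
    refine mul_nonneg ?_ (pathWeight_nonneg G t v ω.2)
    have := exp_neg_one_le
    split_ifs
    · linarith
    · exact (Real.exp_pos _).le
  sum_eq_one v := by
    simp only [startWeight, Fintype.sum_prod_type, Fintype.sum_bool, if_true, Bool.false_eq_true,
      if_false, ← Finset.mul_sum, sum_pathWeight]
    ring

lemma sum_startWeight_present (v : V) (S : (Fin (t + 1) → V) → Prop) [DecidablePred S]
    [DecidablePred fun ω : Start V t => ω.1 = true ∧ S ω.2] :
    ∑ ω : Start V t, startWeight G t v ω * (if ω.1 = true ∧ S ω.2 then 1 else 0) =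
      (1 - Real.exp (-1)) * ∑ γ, pathWeight G t v γ * (if S γ then 1 else 0) := by
  rw [Fintype.sum_prod_type]
  simp only [startWeight, Fintype.sum_bool, if_true, Bool.false_eq_true, if_false, true_and,
    false_and, mul_zero, Finset.sum_const_zero, add_zero, Finset.mul_sum, mul_assoc]

end Measurable

variable (G : SimpleGraph V) [DecidableRel G.Adj] (t : ℕ)

/-- The nearby vertices whose walker meets the walker of `v` by time `t`. -/
noncomputable def contacts (ξ : V → Start V t) (v : V) : Finset V :=
  ((reach G (2 * t) v).erase v).filter fun u =>
    (ξ u).1 = true ∧ ∃ i, (ξ v).2 i = (ξ u).2 i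

/-- The nearby vertices whose walker is at time `t` at the same place as the walker of `v`. -/
noncomputable def crowd (ξ : V → Start V t) (v : V) : Finset V :=
  ((reach G (2 * t) v).erase v).filter fun u =>
    (ξ u).1 = true ∧ (ξ u).2 (Fin.last t) = (ξ v).2 (Fin.last t)

/-- The vertices whose walker exists, has many contacts by time `t` and is in a place that is not
crowded at time `t`. -/
noncomputable def good (ξ : V → Start V t) : Finset V :=
  Finset.univ.filter fun v =>
    (ξ v).1 = true ∧ 2800 ≤ (contacts G t ξ v).card ∧ (crowd G t ξ v).card ≤ 200

variable {G t} {d : ℕ} {lam : ℝ}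

/-- Changing the walker of one vertex changes the set of good vertices only nearby. -/
lemma abs_card_good_update_sub_le (hreg : G.IsRegularOfDegree d) (ξ : V → Start V t) (u : V)
    (ω : Start V t) :
    |((good G t (Function.update ξ u ω)).card : ℝ) - (good G t ξ).card| ≤
      ((d + 1 : ℕ) : ℝ) ^ (2 * t) := by
  -- Whether `v` is good depends only on the walkers of vertices in `reach G (2 * t) v`, and this
  -- relation is symmetric.
  have hsub : ∀ (ξ : V → Start V t) ω,
      good G t (Function.update ξ u ω) ⊆ good G t ξ ∪ reach G (2 * t) u := by
    intro ξ ω v hv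
    rw [Finset.mem_union]
    by_cases hvu : v ∈ reach G (2 * t) u
    · exact Or.inr hvu
    · left
      have hne : v ≠ u := fun h => hvu (h ▸ mem_reach_self G (2 * t) v)
      have hmem : ∀ w ∈ (reach G (2 * t) v).erase v, w ≠ u := by
        rintro w hw rfl
        exact hvu ((mem_reach_comm hreg).1 (Finset.mem_of_mem_erase hw))
      have h1 : contacts G t (Function.update ξ u ω) v = contacts G t ξ v := by
        refine Finset.filter_congr fun w hw => ?_
        rw [Function.update_of_ne hne, Function.update_of_ne (hmem w hw)]
      have h2 : crowd G t (Function.update ξ u ω) v = crowd G t ξ v := by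
        refine Finset.filter_congr fun w hw => ?_
        rw [Function.update_of_ne hne, Function.update_of_ne (hmem w hw)]
      simp only [good, Finset.mem_filter, Finset.mem_univ, true_and, h1, h2,
        Function.update_of_ne hne] at hv ⊢
      exact hv
  have hle : ∀ (ξ : V → Start V t) ω, ((good G t (Function.update ξ u ω)).card : ℝ) ≤
      (good G t ξ).card + ((d + 1 : ℕ) : ℝ) ^ (2 * t) := by
    intro ξ ω
    have := (Finset.card_le_card (hsub ξ ω)).trans ((Finset.card_union_le _ _).trans
      (Nat.add_le_add_left (card_reach_le hreg (2 * t) u) _))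
    exact_mod_cast this
  have h1 := hle ξ ω
  have h2 := hle (Function.update ξ u ω) (ξ u)
  rw [Function.update_idem, Function.update_eq_self] at h2
  rw [abs_le]
  constructor <;> linarith

variable [MeasurableSpace V] [DiscreteMeasurableSpace V]

/-- Given its trajectory, the walker of a vertex is unlikely to have few contacts. -/
lemma prodExp_contacts_lt_le (hreg : G.IsRegularOfDegree d) (hconn : G.Connected)
    (hexp : IsExpander G lam) (hlam0 : 0 < lam) (hlam : lam ≤ 1)
    (hn : 40000 ≤ Fintype.card V) (ht : 40000 ≤ lam * (t + 1)) (v : V) (ω₀ : Start V t)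
    (hγ : pathWeight G t v ω₀.2 ≠ 0) :
    prodExp (startWeight G t) (fun ξ => if ξ v = ω₀ ∧ (contacts G t ξ v).card < 2800
      then 1 else 0) ≤ startWeight G t v ω₀ * (1 / 200) := by
  classical
  have hw := isWeight_startWeight G t
  set T := (reach G (2 * t) v).erase v with hT
  have hch := hw.prodExp_exp_card_le v ω₀ T (Finset.notMem_erase v _)
    (fun _ ω => ω.1 = true ∧ ∃ i, ω₀.2 i = ω.2 i) (-1)
  have hsum : ∑ u ∈ T, ∑ ω : Start V t, startWeight G t u ω *
      (if ω.1 = true ∧ ∃ i, ω₀.2 i = ω.2 i then 1 else 0) =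
      (1 - Real.exp (-1)) * ∑ u ∈ T,
        ∑ γ', pathWeight G t u γ' * (if ∃ i, ω₀.2 i = γ' i then 1 else 0) := by
    rw [Finset.mul_sum]
    exact Finset.sum_congr rfl fun u _ =>
      sum_startWeight_present G t u (fun γ' => ∃ i, ω₀.2 i = γ' i)
  have hhit := le_sum_sum_pathWeight_hit hreg hconn hexp hlam0 hlam ω₀.2 v hγ hn ht
  rw [hsum] at hch
  calc prodExp (startWeight G t) (fun ξ => if ξ v = ω₀ ∧ (contacts G t ξ v).card < 2800
      then 1 else 0)
      ≤ prodExp (startWeight G t) (fun ξ => Real.exp 2800 * ((if ξ v = ω₀ then 1 else 0) *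
          Real.exp (-1 * (T.filter fun u => (ξ u).1 = true ∧ ∃ i, ω₀.2 i = (ξ u).2 i).card))) := by
        refine hw.prodExp_mono fun ξ => ?_
        split_ifs with h h' h'
        · obtain ⟨hv, hc⟩ := h
          have hc' : (T.filter fun u => (ξ u).1 = true ∧ ∃ i, ω₀.2 i = (ξ u).2 i).card < 2800 := by
            rw [contacts, hv] at hc
            exact hc
          have hc2 : ((T.filter fun u => (ξ u).1 = true ∧ ∃ i, ω₀.2 i = (ξ u).2 i).card : ℝ)
              ≤ 2800 := by exact_mod_cast hc'.le
          rw [one_mul, ← Real.exp_add, Real.one_le_exp_iff]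
          linarith
        · exact absurd h.1 h'
        · positivity
        · simp
    -- One factor `1 - 1/e ≥ 0.63` is the probability of presence and another comes from the
    -- exponential moment at `-1`; `0.63 ^ 2 * 9999 > 3968`.
    _ ≤ Real.exp 2800 * (startWeight G t v ω₀ * Real.exp (-3968)) := by
        rw [prodExp_mul_left]
        refine mul_le_mul_of_nonneg_left (hch.trans ?_) (Real.exp_pos _).le
        refine mul_le_mul_of_nonneg_left (Real.exp_le_exp.2 ?_) (hw.nonneg v ω₀)
        have he := exp_neg_one_le
        have h1 : 63 / 100 * 9999 ≤ (1 - Real.exp (-1)) * ∑ u ∈ T,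
            ∑ γ', pathWeight G t u γ' * (if ∃ i, ω₀.2 i = γ' i then (1 : ℝ) else 0) :=
          mul_le_mul (by linarith) hhit (by norm_num) (by linarith)
        nlinarith
    _ ≤ startWeight G t v ω₀ * (1 / 200) := by
        have h1 : Real.exp 2800 * Real.exp (-3968) ≤ 1 / 200 := by
          rw [← Real.exp_add, show (2800 : ℝ) + -3968 = -1168 by norm_num, Real.exp_neg,
            ← one_div]
          refine one_div_le_one_div_of_le (by norm_num) ?_
          linarith [Real.add_one_le_exp (1168 : ℝ)]
        rw [mul_left_comm]
        exact mul_le_mul_of_nonneg_left h1 (hw.nonneg v ω₀)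

/-- Given its trajectory, the walker of a vertex is unlikely to end up in a crowded place. -/
lemma prodExp_lt_crowd_le (hreg : G.IsRegularOfDegree d) (v : V) (ω₀ : Start V t) :
    prodExp (startWeight G t) (fun ξ => if ξ v = ω₀ ∧ 200 < (crowd G t ξ v).card
      then 1 else 0) ≤ startWeight G t v ω₀ * (1 / 190) := by
  classical
  have hw := isWeight_startWeight G t
  set T := (reach G (2 * t) v).erase v with hT
  set a := ω₀.2 (Fin.last t) with ha
  have hch := hw.prodExp_exp_card_le v ω₀ T (Finset.notMem_erase v _)
    (fun _ ω => ω.1 = true ∧ ω.2 (Fin.last t) = a) 1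
  -- Column sums of `P ^ t` equal one, so at most one other walker is expected at `a`.
  have hsum : ∑ u ∈ T, ∑ ω : Start V t, startWeight G t u ω *
      (if ω.1 = true ∧ ω.2 (Fin.last t) = a then 1 else 0) ≤ 1 := by
    have h1 : ∀ u, ∑ ω : Start V t, startWeight G t u ω *
        (if ω.1 = true ∧ ω.2 (Fin.last t) = a then 1 else 0) =
        (1 - Real.exp (-1)) * (lazyP G ^ t) u a := by
      intro u
      rw [sum_startWeight_present G t u (fun γ' => γ' (Fin.last t) = a), sum_pathWeight_apply,
        Fin.val_last]
    simp only [h1, ← Finset.mul_sum]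
    have h2 : ∑ u ∈ T, (lazyP G ^ t) u a ≤ 1 := by
      rw [← sum_lazyP_pow_left hreg t a]
      exact Finset.sum_le_sum_of_subset_of_nonneg (Finset.subset_univ _)
        fun u _ _ => lazyP_pow_nonneg G t u a
    have h3 : 0 ≤ ∑ u ∈ T, (lazyP G ^ t) u a :=
      Finset.sum_nonneg fun u _ => lazyP_pow_nonneg G t u a
    have h4 := Real.exp_pos (-1 : ℝ)
    nlinarith
  calc prodExp (startWeight G t) (fun ξ => if ξ v = ω₀ ∧ 200 < (crowd G t ξ v).card
      then 1 else 0)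
      ≤ prodExp (startWeight G t) (fun ξ => Real.exp (-200) * ((if ξ v = ω₀ then 1 else 0) *
          Real.exp (1 * (T.filter fun u => (ξ u).1 = true ∧ (ξ u).2 (Fin.last t) = a).card))) := by
        refine hw.prodExp_mono fun ξ => ?_
        split_ifs with h h' h'
        · obtain ⟨hv, hc⟩ := h
          have hc' : 200 < (T.filter fun u => (ξ u).1 = true ∧ (ξ u).2 (Fin.last t) = a).card := by
            rw [crowd, hv] at hc
            exact hc
          have hc2 : (200 : ℝ) ≤
              ((T.filter fun u => (ξ u).1 = true ∧ (ξ u).2 (Fin.last t) = a).card : ℝ) := by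
            exact_mod_cast hc'.le
          rw [one_mul, ← Real.exp_add, Real.one_le_exp_iff]
          linarith
        · exact absurd h.1 h'
        · positivity
        · simp
    _ ≤ Real.exp (-200) * (startWeight G t v ω₀ * Real.exp 2) := by
        rw [prodExp_mul_left]
        refine mul_le_mul_of_nonneg_left (hch.trans ?_) (Real.exp_pos _).le
        refine mul_le_mul_of_nonneg_left (Real.exp_le_exp.2 ?_) (hw.nonneg v ω₀)
        have he := Real.exp_one_lt_d9
        have he2 := Real.add_one_le_exp (1 : ℝ)
        have := mul_le_mul_of_nonneg_left hsum (by linarith : 0 ≤ Real.exp 1 - 1)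
        norm_num at he
        linarith
    _ ≤ startWeight G t v ω₀ * (1 / 190) := by
        have h1 : Real.exp (-200) * Real.exp 2 ≤ 1 / 190 := by
          rw [← Real.exp_add, show (-200 : ℝ) + 2 = -198 by norm_num, Real.exp_neg, ← one_div]
          refine one_div_le_one_div_of_le (by norm_num) ?_
          linarith [Real.add_one_le_exp (198 : ℝ)]
        rw [mul_left_comm]
        exact mul_le_mul_of_nonneg_left h1 (hw.nonneg v ω₀)

/-- A walker is present with probability at least `0.63`; given its trajectory, the two failures
cost at most `1/200 + 1/190 < 0.02`, and `0.63 * 0.98 > 3/5`. -/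
lemma le_prodExp_card_good (hreg : G.IsRegularOfDegree d) (hconn : G.Connected)
    (hexp : IsExpander G lam) (hlam0 : 0 < lam) (hlam : lam ≤ 1)
    (hn : 40000 ≤ Fintype.card V) (ht : 40000 ≤ lam * (t + 1)) :
    (3 / 5 : ℝ) * Fintype.card V ≤
      prodExp (startWeight G t) (fun ξ => ((good G t ξ).card : ℝ)) := by
  classical
  have hw := isWeight_startWeight G t
  have hpath : ∀ v (γ : Fin (t + 1) → V), (98 / 100 : ℝ) * startWeight G t v (true, γ) ≤
      prodExp (startWeight G t) (fun ξ => if ξ v = (true, γ) ∧ v ∈ good G t ξ then 1 else 0) := by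
    intro v γ
    by_cases hγ : pathWeight G t v γ = 0
    · simp only [startWeight, hγ, mul_zero]
      exact hw.prodExp_nonneg fun ξ => by split_ifs <;> norm_num
    · have h1 := prodExp_contacts_lt_le hreg hconn hexp hlam0 hlam hn ht v (true, γ) hγ
      have h2 := prodExp_lt_crowd_le hreg v (true, γ)
      have h3 : prodExp (startWeight G t) (fun ξ => if ξ v = (true, γ) then (1 : ℝ) else 0) =
          startWeight G t v (true, γ) := by
        have := hw.prodExp_prod_mem {v} (fun _ ω _ => if ω = (true, γ) then (1 : ℝ) else 0)
          (fun _ _ _ _ _ _ => rfl)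
        simp only [Finset.prod_singleton] at this
        rw [this, hw.prodExp_const]
        simp
      have h4 : prodExp (startWeight G t) (fun ξ => if ξ v = (true, γ) then (1 : ℝ) else 0) ≤
          prodExp (startWeight G t) (fun ξ => if ξ v = (true, γ) ∧ v ∈ good G t ξ then 1 else 0) +
          prodExp (startWeight G t) (fun ξ =>
            if ξ v = (true, γ) ∧ (contacts G t ξ v).card < 2800 then 1 else 0) +
          prodExp (startWeight G t) (fun ξ =>
            if ξ v = (true, γ) ∧ 200 < (crowd G t ξ v).card then 1 else 0) := by
        rw [← prodExp_add, ← prodExp_add]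
        refine hw.prodExp_mono fun ξ => ?_
        by_cases hv : ξ v = (true, γ)
        · by_cases hc : (contacts G t ξ v).card < 2800
          · simp only [hv, hc, and_self, if_true]
            split_ifs <;> norm_num
          · by_cases hk : 200 < (crowd G t ξ v).card
            · simp only [hv, hk, and_self, if_true]
              split_ifs <;> norm_num
            · have : v ∈ good G t ξ := by
                simp only [good, Finset.mem_filter, Finset.mem_univ, true_and]
                exact ⟨by rw [hv], not_lt.1 hc, not_lt.1 hk⟩
              simp only [hv, this, and_self, if_true]
              split_ifs <;> norm_num
        · simp [hv]
      have h5 := hw.nonneg v (true, γ)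
      linarith
  have hvert : ∀ v, (3 / 5 : ℝ) ≤
      prodExp (startWeight G t) (fun ξ => if v ∈ good G t ξ then 1 else 0) := by
    intro v
    have h1 : ∑ γ, startWeight G t v (true, γ) = 1 - Real.exp (-1) := by
      simp only [startWeight, if_true, ← Finset.mul_sum, sum_pathWeight, mul_one]
    have h2 : ∑ γ, prodExp (startWeight G t)
        (fun ξ => if ξ v = (true, γ) ∧ v ∈ good G t ξ then 1 else 0) ≤
        prodExp (startWeight G t) (fun ξ => if v ∈ good G t ξ then 1 else 0) := by
      rw [← prodExp_sum]
      refine hw.prodExp_mono fun ξ => ?_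
      by_cases hv : v ∈ good G t ξ
      · have hb : (ξ v).1 = true := (Finset.mem_filter.1 hv).2.1
        have : ∀ γ, ξ v = (true, γ) ↔ (ξ v).2 = γ := fun γ => by
          rw [Prod.ext_iff]; simp [hb]
        simp only [hv, and_true, this, Finset.sum_ite_eq, Finset.mem_univ, if_true, le_refl]
      · simp [hv]
    have h3 := Finset.sum_le_sum fun γ (_ : γ ∈ Finset.univ) => hpath v γ
    rw [← Finset.mul_sum, h1] at h3
    have := exp_neg_one_le
    linarith
  have hcard : ∀ ξ : V → Start V t, ((good G t ξ).card : ℝ) =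
      ∑ v, if v ∈ good G t ξ then (1 : ℝ) else 0 := by
    intro ξ
    rw [Finset.sum_boole, Finset.filter_mem_eq_inter, Finset.univ_inter]
  rw [prodExp_congr hcard, prodExp_sum]
  have := Finset.card_nsmul_le_sum Finset.univ _ (3 / 5 : ℝ) fun v _ => hvert v
  rw [Finset.card_univ, nsmul_eq_mul] at this
  linarith

/-- The exponential bound is McDiarmid's inequality and the bound `4/5` is Markov's. The latter is
needed when `n` is not large compared with `(d + 1) ^ (4 * t)`, where the former is close to `1`. -/
lemma prodExp_card_good_lt_le (hreg : G.IsRegularOfDegree d) (hconn : G.Connected)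
    (hexp : IsExpander G lam) (hlam0 : 0 < lam) (hlam : lam ≤ 1)
    (hn : 40000 ≤ Fintype.card V) (ht : 40000 ≤ lam * (t + 1)) :
    prodExp (startWeight G t)
      (fun ξ => if ((good G t ξ).card : ℝ) < Fintype.card V / 2 then 1 else 0) ≤
      min (Real.exp (-(Fintype.card V / 200 / (((d + 1 : ℕ) : ℝ) ^ (2 * t)) ^ 2))) (4 / 5) := by
  have hw := isWeight_startWeight G t
  have hmean := le_prodExp_card_good hreg hconn hexp hlam0 hlam hn ht
  refine le_min ?_ ?_
  · refine (hw.prodExp_lt_le (fun ξ => ((good G t ξ).card : ℝ)) (((d + 1 : ℕ) : ℝ) ^ (2 * t))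
      (by positivity) (fun ξ u ω => abs_card_good_update_sub_le hreg ξ u ω) (Fintype.card V / 2)
      (1 / 10) (by norm_num) (by linarith)).trans (Real.exp_le_exp.2 ?_)
    rw [show ((1 : ℝ) / 10) ^ 2 / 2 * Fintype.card V = Fintype.card V / 200 by ring]
  · have hn0 : (0 : ℝ) < Fintype.card V := by
      have : (40000 : ℝ) ≤ Fintype.card V := by exact_mod_cast hn
      linarith
    calc prodExp (startWeight G t)
          (fun ξ => if ((good G t ξ).card : ℝ) < Fintype.card V / 2 then 1 else 0)
        ≤ prodExp (startWeight G t)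
          (fun ξ => 2 - 2 / Fintype.card V * ((good G t ξ).card : ℝ)) := by
          refine hw.prodExp_mono fun ξ => ?_
          have h1 : ((good G t ξ).card : ℝ) ≤ Fintype.card V := by
            exact_mod_cast Finset.card_le_univ _
          split_ifs with h
          · have : 2 / (Fintype.card V : ℝ) * ((good G t ξ).card : ℝ) ≤
                2 / Fintype.card V * (Fintype.card V / 2) :=
              mul_le_mul_of_nonneg_left h.le (by positivity)
            have h2 : 2 / (Fintype.card V : ℝ) * (Fintype.card V / 2) = 1 := by field_simp
            linarith
          · have : 2 / (Fintype.card V : ℝ) * ((good G t ξ).card : ℝ) ≤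
                2 / Fintype.card V * Fintype.card V :=
              mul_le_mul_of_nonneg_left h1 (by positivity)
            have h2 : 2 / (Fintype.card V : ℝ) * Fintype.card V = 2 := by field_simp
            linarith
      _ ≤ 4 / 5 := by
          rw [prodExp_sub, hw.prodExp_const, prodExp_mul_left]
          have : 2 / (Fintype.card V : ℝ) * (3 / 5 * Fintype.card V) ≤ 2 / Fintype.card V *
              prodExp (startWeight G t) (fun ξ => ((good G t ξ).card : ℝ)) :=
            mul_le_mul_of_nonneg_left hmean (by positivity)
          have h2 : 2 / (Fintype.card V : ℝ) * (3 / 5 * Fintype.card V) = 6 / 5 := by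
            field_simp; norm_num
          linarith

/-- The probability that all classes of the meeting relation are small. -/
lemma prodExp_prodExp_forall_class_lt_le (hreg : G.IsRegularOfDegree d) (hconn : G.Connected)
    (hexp : IsExpander G lam) (hlam0 : 0 < lam) (hlam : lam ≤ 1) {r : ℕ}
    (hn : 40000 ≤ Fintype.card V) (ht : 40000 ≤ lam * (t + 1)) (hr : 80000 ≤ lam * r)
    [∀ ξ : V → Start V t, DecidablePred fun y : V → V => ∀ v, (Nat.card {u // Quot.mk (WalkersMeet (t := t) ξ y) u =
      Quot.mk (WalkersMeet ξ y) v} : ℝ) < Fintype.card V / 6] :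
    prodExp (startWeight G t) (fun ξ : V → Start V t =>
      prodExp (fun v y => (lazyP G ^ r) ((ξ v).2 (Fin.last t)) y) (fun y : V → V =>
        if ∀ v, (Nat.card {u // Quot.mk (WalkersMeet ξ y) u = Quot.mk (WalkersMeet ξ y) v} : ℝ) <
          Fintype.card V / 6 then 1 else 0)) ≤
      min (Real.exp (-(Fintype.card V / 200 / (((d + 1 : ℕ) : ℝ) ^ (2 * t)) ^ 2))) (4 / 5) +
        Real.exp (-(Fintype.card V / 2800)) := by
  classical
  have hw := isWeight_startWeight G t
  have hmix : ((1 - lam) ^ r) ^ 2 * 201 * 576 ≤ 1 := by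
    have h1 : (1 - lam) ^ r ≤ Real.exp (-80000) := by
      calc (1 - lam) ^ r ≤ Real.exp (-lam) ^ r :=
            pow_le_pow_left₀ (by linarith) (Real.one_sub_le_exp_neg lam) r
        _ = Real.exp (-(lam * r)) := by rw [← Real.exp_nat_mul]; ring_nf
        _ ≤ _ := Real.exp_le_exp.2 (by linarith)
    have h2 : Real.exp (-80000) ≤ 1 / 80001 := by
      rw [Real.exp_neg, ← one_div]
      refine one_div_le_one_div_of_le (by norm_num) ?_
      linarith [Real.add_one_le_exp (80000 : ℝ)]
    have h3 : 0 ≤ (1 - lam) ^ r := pow_nonneg (by linarith) r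
    have h4 : ((1 - lam) ^ r) ^ 2 ≤ (1 / 80001) ^ 2 := pow_le_pow_left₀ h3 (h1.trans h2) 2
    linarith
  calc _ ≤ prodExp (startWeight G t) (fun ξ =>
        (if ((good G t ξ).card : ℝ) < Fintype.card V / 2 then 1 else 0) +
          Real.exp (-(Fintype.card V / 2800))) := by
        refine hw.prodExp_mono_of_ne fun ξ hξ => ?_
        have hpw : ∀ v, pathWeight G t v (ξ v).2 ≠ 0 := fun v => right_ne_zero_of_mul (hξ v)
        split_ifs with hS
        · have hw' := isWeight_lazyP_pow (G := G) r fun v => (ξ v).2 (Fin.last t)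
          refine (le_add_of_nonneg_right (Real.exp_pos _).le).trans' ?_
          refine (hw'.prodExp_mono (g := fun _ => 1) fun y => ?_).trans_eq (hw'.prodExp_const 1)
          split_ifs <;> norm_num
        · rw [zero_add]
          refine prodExp_forall_class_lt_le hreg hconn hexp r (fun v => (ξ v).2 (Fin.last t))
            (good G t ξ) 201 ?_ hmix (not_lt.1 hS)
            (fun u v => (ξ u).1 = true ∧ (ξ v).1 = true ∧ ∃ i, (ξ u).2 i = (ξ v).2 i)
            (fun y => WalkersMeet ξ y) ?_ (fun y u v h => ⟨h.1, h.2.1, Or.inl h.2.2⟩)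
            (fun y u hu v hv huv => ⟨(Finset.mem_filter.1 hu).2.1, (Finset.mem_filter.1 hv).2.1,
              Or.inr huv⟩)
          -- All good vertices whose walkers are at `a` lie in the crowd of any one of them,
          -- together with that vertex: hence `201`. They are within `reach` of each other because
          -- the trajectories have positive weight.
          · intro a
            rcases ((good G t ξ).filter fun v => (ξ v).2 (Fin.last t) = a).eq_empty_or_nonempty
              with h0 | ⟨v, hv⟩
            · rw [h0]; norm_num
            · obtain ⟨hvg, hva⟩ := Finset.mem_filter.1 hv
              have hsub : ((good G t ξ).filter fun v => (ξ v).2 (Fin.last t) = a) ⊆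
                  insert v (crowd G t ξ v) := by
                intro u hu
                obtain ⟨hug, hua⟩ := Finset.mem_filter.1 hu
                by_cases huv : u = v
                · exact huv ▸ Finset.mem_insert_self _ _
                · refine Finset.mem_insert_of_mem (Finset.mem_filter.2
                    ⟨Finset.mem_erase.2 ⟨huv, ?_⟩, (Finset.mem_filter.1 hug).2.1,
                      hua.trans hva.symm⟩)
                  have e1 := lazyP_pow_ne_zero_of_pathWeight G (hpw u) (Fin.last t)
                  have e2 := lazyP_pow_ne_zero_of_pathWeight G (hpw v) (Fin.last t)
                  rw [hua] at e1
                  rw [hva] at e2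
                  exact mem_reach_of_common hreg (Nat.lt_succ_iff.1 (Fin.last t).2) e1 e2
              have h1 := (Finset.card_le_card hsub).trans (Finset.card_insert_le _ _)
              have h2 := (Finset.mem_filter.1 hvg).2.2.2
              exact_mod_cast (h1.trans (Nat.add_le_add_right h2 1) : _ ≤ 201)
          · intro v hv
            obtain ⟨-, hb, hK, -⟩ := Finset.mem_filter.1 hv
            refine hK.trans ?_
            rw [Nat.card_eq_fintype_card, Fintype.card_subtype]
            refine Finset.card_le_card fun u hu => ?_
            obtain ⟨-, hub, i, hi⟩ := Finset.mem_filter.1 hu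
            rw [Finset.mem_filter]
            exact ⟨Finset.mem_univ u, Quot.sound ⟨hub, hb, i, hi.symm⟩⟩
    _ ≤ _ := by
        rw [prodExp_add, hw.prodExp_const]
        have := prodExp_card_good_lt_le hreg hconn hexp hlam0 hlam hn ht
        linarith

end Good

/-! ### Transfer to the Poisson model -/

section Model

/-- The presence flag of every vertex and the trajectory up to time `t` of its first walker. -/
def startOf {V : Type*} (t : ℕ) (ω : Config V) (v : V) : Start V t :=
  (decide (1 ≤ (ω v).1), fun i => (ω v).2 0 i)

/-- The position at time `s` of the first walker of every vertex. -/
def endOf {V : Type*} (s : ℕ) (ω : Config V) (v : V) : V := (ω v).2 0 s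

/-- Equality in `Quot` means being related by the generated equivalence. A vertex without a walker
is a class by itself, hence the alternative `u = v`. -/
lemma acquainted_of_quot_eq {V : Type*} {t s : ℕ} (hts : t ≤ s) (ω : Config V) {u v : V}
    (h : Quot.mk (WalkersMeet (startOf t ω) (endOf s ω)) u = Quot.mk _ v) :
    u = v ∨ ∃ (hu : 0 < (ω u).1) (hv : 0 < (ω v).1), Acquainted ω s ⟨(u, 0), hu⟩ ⟨(v, 0), hv⟩ := by
  have hsymm : ∀ a b, Acquainted ω s a b → Acquainted ω s b a := by
    intro a b hab
    have hmet : ∀ {a b}, MetBy ω s a b → MetBy ω s b a := fun ⟨t₀, ht, he⟩ => ⟨t₀, ht, he.symm⟩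
    induction hab with
    | single h => exact Relation.TransGen.single (hmet h)
    | tail _ h ih => exact Relation.TransGen.head (hmet h) ih
  induction Quot.eqvGen_exact h with
  | rel u v huv =>
    right
    obtain ⟨hu, hv, hm⟩ := huv
    refine ⟨of_decide_eq_true hu, of_decide_eq_true hv, Relation.TransGen.single ?_⟩
    rcases hm with ⟨i, hi⟩ | hm
    · exact ⟨i, (Nat.lt_succ_iff.1 i.2).trans hts, hi⟩
    · exact ⟨s, le_rfl, hm⟩
  | refl u => exact Or.inl rfl
  | symm u v huv ih =>
    rcases ih (Quot.eqvGen_sound huv) with rfl | ⟨hu, hv, hm⟩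
    · exact Or.inl rfl
    · exact Or.inr ⟨hv, hu, hsymm _ _ hm⟩
  | trans u v w huv hvw ih₁ ih₂ =>
    rcases ih₁ (Quot.eqvGen_sound huv) with rfl | ⟨hu, hv, hm⟩
    · exact ih₂ (Quot.eqvGen_sound hvw)
    · rcases ih₂ (Quot.eqvGen_sound hvw) with rfl | ⟨hv', hw, hm'⟩
      · exact Or.inr ⟨hu, hv, hm⟩
      · exact Or.inr ⟨hu, hw, hm.trans hm'⟩

variable {V : Type*} [Fintype V] {G : SimpleGraph V} [DecidableRel G.Adj] {d : ℕ}

lemma startMean_eq_one (hreg : G.IsRegularOfDegree d) (hd : 0 < d) (v : V) :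
    startMean G v = 1 := by
  have h : 2 * G.edgeFinset.card = Fintype.card V * d := by
    rw [← G.sum_degrees_eq_twice_card_edges, Finset.sum_congr rfl fun u _ => hreg u,
      Finset.sum_const, Finset.card_univ, smul_eq_mul]
  have h2 : (2 : ℝ≥0) * G.edgeFinset.card = Fintype.card V * d := by exact_mod_cast h
  have : Nonempty V := ⟨v⟩
  have hn : (Fintype.card V : ℝ≥0) ≠ 0 := by exact_mod_cast Fintype.card_ne_zero
  have hd' : (d : ℝ≥0) ≠ 0 := by exact_mod_cast hd.ne'
  rw [startMean, h2, hreg v]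
  field_simp

/-- Connectedness needs at least `n - 1` edges, while degree at most one allows only `n/2`. -/
lemma two_le_of_connected (hreg : G.IsRegularOfDegree d) (hconn : G.Connected)
    (hn : 3 ≤ Fintype.card V) : 2 ≤ d := by
  have h : 2 * G.edgeFinset.card = Fintype.card V * d := by
    rw [← G.sum_degrees_eq_twice_card_edges, Finset.sum_congr rfl fun u _ => hreg u,
      Finset.sum_const, Finset.card_univ, smul_eq_mul]
  have h2 := hconn.card_vert_le_card_edgeSet_add_one
  rw [Nat.card_eq_fintype_card, Nat.card_eq_fintype_card, ← SimpleGraph.edgeFinset_card] at h2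
  by_contra hd
  have : Fintype.card V * d ≤ Fintype.card V * 1 := Nat.mul_le_mul_left _ (by omega)
  omega

instance (ω : Config V) : Finite (Walker ω) := by
  refine Finite.of_injective
    (β := Σ v : V, Fin (ω v).1) (fun w => ⟨w.1.1, ⟨w.1.2, w.2⟩⟩) ?_
  rintro ⟨⟨v, i⟩, hw⟩ ⟨⟨v', i'⟩, hw'⟩ h
  simp only [Sigma.mk.injEq] at h
  obtain ⟨rfl, h⟩ := h
  rw [heq_eq_eq, Fin.mk.injEq] at h
  subst h
  rfl

/-- A large class of vertices gives a large class of walkers. -/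
lemma exists_acquaintanceClass {t s : ℕ} (hts : t ≤ s) (ω : Config V) {m : ℝ} (hm : 1 < m) {v : V}
    (h : m ≤ Nat.card {u // Quot.mk (WalkersMeet (startOf t ω) (endOf s ω)) u = Quot.mk _ v}) :
    ∃ a : Walker ω, m ≤ (acquaintanceClass ω s a).ncard := by
  set C := {u : V // Quot.mk (WalkersMeet (startOf t ω) (endOf s ω)) u = Quot.mk _ v} with hC
  have hcard : 1 < Nat.card C := by
    have : (1 : ℝ) < Nat.card C := hm.trans_le h
    exact_mod_cast this
  -- Without a walker at `v` the class would be a singleton, against `1 < m`.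
  have hv : 0 < (ω v).1 := by
    by_contra hv
    have : Subsingleton C := by
      refine ⟨fun a b => Subtype.ext ?_⟩
      rcases acquainted_of_quot_eq hts ω a.2 with ha | ⟨-, hv', -⟩
      · rcases acquainted_of_quot_eq hts ω b.2 with hb | ⟨-, hv', -⟩
        · rw [ha, hb]
        · exact absurd hv' hv
      · exact absurd hv' hv
    exact absurd hcard (not_lt.2 (Finite.card_le_one_iff_subsingleton.2 this))
  refine ⟨⟨(v, 0), hv⟩, h.trans ?_⟩
  have hmem : ∀ u : C, ∃ hu : 0 < (ω u.1).1,
      (⟨(u.1, 0), hu⟩ : Walker ω) ∈ acquaintanceClass ω s ⟨(v, 0), hv⟩ := by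
    intro u
    rcases acquainted_of_quot_eq hts ω u.2.symm with hu | ⟨_, hu, hac⟩
    · refine ⟨hu ▸ hv, ?_⟩
      have : (⟨(u.1, 0), hu ▸ hv⟩ : Walker ω) = ⟨(v, 0), hv⟩ := Subtype.ext (Prod.ext hu.symm rfl)
      rw [this]
      exact Relation.TransGen.single ⟨0, Nat.zero_le s, rfl⟩
    · exact ⟨hu, hac⟩
  choose hpos hcls using hmem
  have hinj : Function.Injective fun u : C =>
      (⟨⟨(u.1, 0), hpos u⟩, hcls u⟩ : acquaintanceClass ω s ⟨(v, 0), hv⟩) := by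
    intro a b hab
    simp only [Subtype.mk.injEq, Prod.mk.injEq, and_true] at hab
    exact Subtype.ext hab
  have := Nat.card_le_card_of_injective _ hinj
  rw [Nat.card_coe_set_eq] at this
  exact_mod_cast this

variable [DecidableEq V] [MeasurableSpace V] [DiscreteMeasurableSpace V]

lemma poissonMeasure_one_present (b : Bool) :
    (poissonMeasure 1).real {N | decide (1 ≤ N) = b} =
      if b = true then 1 - Real.exp (-1) else Real.exp (-1) := by
  have h0 : (poissonMeasure 1).real {0} = Real.exp (-1) := by
    rw [poissonMeasure_real_singleton]; simp
  cases b with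
  | false =>
    have : {N : ℕ | decide (1 ≤ N) = false} = {0} := by
      ext N; simp
    rw [this, h0]; simp
  | true =>
    have : {N : ℕ | decide (1 ≤ N) = true} = {0}ᶜ := by
      ext N; simp [Nat.one_le_iff_ne_zero]
    rw [this, probReal_compl_eq_one_sub (MeasurableSet.singleton 0), h0]; simp

/-- The law of the first walkers of the vertices, as a finite sum. -/
lemma modelLaw_real_eq (hreg : G.IsRegularOfDegree d) (hd : 0 < d) (t r : ℕ)
    (S : (V → Start V t) → (V → V) → Prop) [∀ ξ, DecidablePred (S ξ)] :
    (modelLaw G).real {ω | S (startOf t ω) (endOf (t + r) ω)} =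
      prodExp (startWeight G t) (fun ξ =>
        prodExp (fun v y => (lazyP G ^ r) ((ξ v).2 (Fin.last t)) y)
          (fun y => if S ξ y then 1 else 0)) := by
  classical
  set f : Config V → (V → Start V t) × (V → V) := fun ω => (startOf t ω, endOf (t + r) ω) with hf
  -- Each fibre of `f` is a box over the vertices constraining only the walker count and the walker
  -- of index `0`, so its probability factorises.
  set c : (V → Start V t) × (V → V) → V → Set (ℕ × (ℕ → ℕ → V)) := fun z v =>
    {N | decide (1 ≤ N) = (z.1 v).1} ×ˢ ((fun g : ℕ → ℕ → V => g 0) ⁻¹'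
      {x | (∀ i : Fin (t + 1), x i = (z.1 v).2 i) ∧ x (t + r) = z.2 v}) with hc
  have hpre : ∀ z, f ⁻¹' {z} = Set.univ.pi (c z) := by
    intro z
    ext ω
    simp only [hf, hc, startOf, endOf, Set.mem_preimage, Set.mem_singleton_iff, Prod.ext_iff,
      funext_iff, Set.mem_univ_pi, Set.mem_prod, Set.mem_ofPred_eq]
    constructor
    · rintro ⟨h1, h2⟩ v
      exact ⟨(h1 v).1, (h1 v).2, h2 v⟩
    · intro h
      exact ⟨fun v => ⟨(h v).1, (h v).2.1⟩, fun v => (h v).2.2⟩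
  have hmx : ∀ z : (V → Start V t) × (V → V), ∀ v, MeasurableSet
      {x : ℕ → V | (∀ i : Fin (t + 1), x i = (z.1 v).2 i) ∧ x (t + r) = z.2 v} := by
    intro z v
    have : {x : ℕ → V | (∀ i : Fin (t + 1), x i = (z.1 v).2 i) ∧ x (t + r) = z.2 v} =
        (fun x : ℕ → V => ((fun i : Fin (t + 1) => x i), x (t + r))) ⁻¹'
          {((z.1 v).2, z.2 v)} := by
      ext x; simp [Prod.ext_iff, funext_iff]
    rw [this]
    exact (MeasurableSet.singleton _).preimage (by fun_prop)
  have hcm : ∀ z v, MeasurableSet (c z v) := fun z v =>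
    MeasurableSet.prod MeasurableSet.of_discrete (measurable_pi_apply 0 (hmx z v))
  have hval : ∀ z, (modelLaw G).real (f ⁻¹' {z}) =
      (∏ v, startWeight G t v (z.1 v)) *
        ∏ v, (lazyP G ^ r) ((z.1 v).2 (Fin.last t)) (z.2 v) := by
    intro z
    rw [hpre, modelLaw, measureReal_def, Measure.pi_pi, ENNReal.toReal_prod,
      ← Finset.prod_mul_distrib]
    refine Finset.prod_congr rfl fun v _ => ?_
    rw [hc, Measure.prod_prod, ENNReal.toReal_mul, ← measureReal_def, startMean_eq_one hreg hd v,
      poissonMeasure_one_present, startWeight, mul_assoc, ← walkLaw_path_end,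
      ← Measure.map_apply (measurable_pi_apply 0) (hmx z v), Measure.infinitePi_map_eval,
      ← measureReal_def]
  have h := sum_measureReal_preimage_singleton (μ := modelLaw G)
    (Finset.univ.filter fun z : (V → Start V t) × (V → V) => S z.1 z.2) (f := f)
    (fun z _ => hpre z ▸ MeasurableSet.univ_pi (hcm z))
  have hset : {ω | S (startOf t ω) (endOf (t + r) ω)} =
      f ⁻¹' ↑(Finset.univ.filter fun z : (V → Start V t) × (V → V) => S z.1 z.2) := by
    ext ω; simp [hf]
  rw [hset, ← h, Finset.sum_filter, Fintype.sum_prod_type]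
  unfold prodExp
  refine Finset.sum_congr rfl fun ξ _ => ?_
  rw [Finset.mul_sum]
  refine Finset.sum_congr rfl fun y _ => ?_
  rw [hval]
  by_cases hS : S ξ y
  · simp only [hS, if_true]; ring
  · simp [hS]

/-- On a large expander there is a class of linear size with high probability. -/
lemma le_modelLaw_real_of_large {lam : ℝ} (hreg : G.IsRegularOfDegree d) (hd : 0 < d)
    (hconn : G.Connected) (hexp : IsExpander G lam) (hlam0 : 0 < lam)
    (hn : 40000 ≤ Fintype.card V) {s : ℕ} (hs : 160000 ≤ lam * s) :
    1 - (min (Real.exp (-(Fintype.card V / 200 / (((d + 1 : ℕ) : ℝ) ^ s) ^ 2))) (4 / 5) +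
        Real.exp (-(Fintype.card V / 2800))) ≤
      (modelLaw G).real {ω | ∃ a : Walker ω,
        (Fintype.card V : ℝ) / 6 ≤ ((acquaintanceClass ω s a).ncard : ℝ)} := by
  classical
  have hlam1 := lam_le_one hreg hconn hexp (by omega)
  -- Halving `s`: `2 * t ≤ s` controls the Lipschitz constant, and the other two bounds keep both
  -- phases long enough.
  obtain ⟨t, r, hts, h1, h2⟩ : ∃ t r, t + r = s ∧ 2 * t ≤ s ∧ s ≤ 2 * r ∧ s ≤ 2 * (t + 1) :=
    ⟨s / 2, s - s / 2, by omega, by omega, by omega, by omega⟩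
  have h2a : (s : ℝ) ≤ 2 * r := by exact_mod_cast h2.1
  have h2b : (s : ℝ) ≤ 2 * (t + 1) := by exact_mod_cast h2.2
  have ht : 40000 ≤ lam * (t + 1) := by nlinarith
  have hr : 80000 ≤ lam * r := by nlinarith
  have hmain := prodExp_prodExp_forall_class_lt_le hreg hconn hexp hlam0 hlam1 hn ht hr
  rw [← modelLaw_real_eq hreg hd t r (fun ξ y => ∀ v, (Nat.card {u // Quot.mk (WalkersMeet ξ y) u =
    Quot.mk (WalkersMeet ξ y) v} : ℝ) < Fintype.card V / 6), hts] at hmain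
  have hmono : min (Real.exp (-(Fintype.card V / 200 / (((d + 1 : ℕ) : ℝ) ^ (2 * t)) ^ 2))) (4 / 5)
      ≤ min (Real.exp (-(Fintype.card V / 200 / (((d + 1 : ℕ) : ℝ) ^ s) ^ 2))) (4 / 5) := by
    refine min_le_min_right _ (Real.exp_le_exp.2 (neg_le_neg ?_))
    have hone : (1 : ℝ) ≤ ((d + 1 : ℕ) : ℝ) := by push_cast; linarith [Nat.cast_nonneg (α := ℝ) d]
    have : ((d + 1 : ℕ) : ℝ) ^ (2 * t) ≤ ((d + 1 : ℕ) : ℝ) ^ s := pow_le_pow_right₀ hone h1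
    gcongr
  have hcover : (Set.univ : Set (Config V)) ⊆
      {ω | ∃ a : Walker ω, (Fintype.card V : ℝ) / 6 ≤ ((acquaintanceClass ω s a).ncard : ℝ)} ∪
      {ω | ∀ v, (Nat.card {u // Quot.mk (WalkersMeet (startOf t ω) (endOf s ω)) u =
        Quot.mk _ v} : ℝ) < Fintype.card V / 6} := by
    intro ω _
    by_cases h : ∀ v, (Nat.card {u // Quot.mk (WalkersMeet (startOf t ω) (endOf s ω)) u =
        Quot.mk _ v} : ℝ) < Fintype.card V / 6
    · exact Or.inr h
    · left
      push Not at h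
      obtain ⟨v, hv⟩ := h
      have : (40000 : ℝ) ≤ Fintype.card V := by exact_mod_cast hn
      exact exists_acquaintanceClass (by omega) ω (by linarith) hv
  have hprob := (measureReal_mono hcover (measure_ne_top _ _)).trans
    (measureReal_union_le (μ := modelLaw G) _ _)
  rw [probReal_univ] at hprob
  linarith

/-- A class has at least `k` walkers whenever `k` walkers start at the same vertex. -/
lemma le_modelLaw_real_of_many_walkers (hreg : G.IsRegularOfDegree d) (hd : 0 < d) (v : V)
    (k s : ℕ) (hk : 0 < k) :
    (poissonMeasure 1).real {k} ≤
      (modelLaw G).real {ω | ∃ a : Walker ω, k ≤ (acquaintanceClass ω s a).ncard} := by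
  have hwalk : ∀ᵐ x ∂walkLaw G v, x 0 = v := by
    have hm : MeasurableSet {x : ℕ → V | x 0 = v} :=
      (MeasurableSet.singleton v).preimage (measurable_pi_apply 0)
    rw [ae_iff, ← Set.compl_ofPred, ← measureReal_eq_zero_iff, probReal_compl_eq_one_sub hm,
      walkLaw_start, sub_self]
  have hall : ∀ᵐ ω ∂modelLaw G, ∀ i, (ω v).2 i 0 = v := by
    have h1 : ∀ᵐ g ∂Measure.infinitePi fun _ : ℕ => walkLaw G v, ∀ i, g i 0 = v :=
      ae_all_iff.2 fun i => (measurePreserving_eval_infinitePi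
        (fun _ : ℕ => walkLaw G v) i).quasiMeasurePreserving.ae hwalk
    have h2 : ∀ᵐ z ∂(poissonMeasure (startMean G v)).prod
        (Measure.infinitePi fun _ : ℕ => walkLaw G v), ∀ i, z.2 i 0 = v :=
      Measure.quasiMeasurePreserving_snd.ae h1
    exact (measurePreserving_eval (fun v => (poissonMeasure (startMean G v)).prod
      (Measure.infinitePi fun _ : ℕ => walkLaw G v)) v).quasiMeasurePreserving.ae h2
  have hN : (modelLaw G).real {ω | (ω v).1 = k} = (poissonMeasure 1).real {k} := by
    have hp := (measurePreserving_fst (μ := poissonMeasure (startMean G v))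
      (ν := Measure.infinitePi fun _ : ℕ => walkLaw G v)).comp
      (measurePreserving_eval (fun v => (poissonMeasure (startMean G v)).prod
        (Measure.infinitePi fun _ : ℕ => walkLaw G v)) v)
    have := hp.measureReal_preimage (s := {k}) (MeasurableSet.singleton k).nullMeasurableSet
    rw [startMean_eq_one hreg hd] at this
    exact this
  rw [← hN, measureReal_def, measureReal_def]
  refine ENNReal.toReal_mono (measure_ne_top _ _) (measure_mono_ae ?_)
  filter_upwards [hall] with ω hω hωk
  have hωk : (ω v).1 = k := hωk
  have h0 : 0 < (ω v).1 := hωk ▸ hk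
  refine ⟨⟨(v, 0), h0⟩, ?_⟩
  have hinj : Function.Injective fun i : Fin k =>
      (⟨⟨(v, i), hωk ▸ i.2⟩, Relation.TransGen.single ⟨0, Nat.zero_le s,
        (hω 0).trans (hω i).symm⟩⟩ : acquaintanceClass ω s ⟨(v, 0), h0⟩) := by
    intro i j hij
    exact Fin.ext (congrArg (fun w => w.1.1.2) hij)
  have := Nat.card_le_card_of_injective _ hinj
  rwa [Nat.card_coe_set_eq, Nat.card_eq_fintype_card, Fintype.card_fin] at this

end Model

end SocialNetwork

/-! ### Choice of the constants -/

theorem theorem5 :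
    ∃ c C₁ : ℝ, 0 < c ∧ 0 < C₁ ∧
      ∀ (V : Type*) [Fintype V] [DecidableEq V] [MeasurableSpace V] [DiscreteMeasurableSpace V]
        (G : SimpleGraph V) [DecidableRel G.Adj] (n d : ℕ) (lam : ℝ),
        Fintype.card V = n → G.Connected → G.IsRegularOfDegree d →
        0 < lam → SocialNetwork.IsExpander G lam →
        ∀ s : ℕ, s = ⌈C₁ / lam⌉₊ →
          1 - Real.exp (-c * (n : ℝ) * (d : ℝ) ^ (-4 * ((s : ℤ) + 1))) ≤
            (SocialNetwork.modelLaw G).real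
              {ω | ∃ a : SocialNetwork.Walker ω,
                (n : ℝ) / 6 ≤ ((SocialNetwork.acquaintanceClass ω s a).ncard : ℝ)} := by
  -- For `n < 40000`, `1 - exp (-(c * m)) ≤ c * n ≤ δ`, where `δ` bounds below the probability of
  -- `40000` walkers starting at one vertex and so meeting at time `0`.
  set δ := (poissonMeasure 1).real {40000} with hδ
  have hδ0 : 0 < δ := poissonMeasure_real_singleton_pos 40000 one_pos
  set c := min (δ / 40000) (1 / 56000) with hc
  have hc0 : 0 < c := lt_min (by positivity) (by norm_num)
  have hcδ : c * 40000 ≤ δ := by linarith [min_le_left (δ / 40000) (1 / 56000 : ℝ)]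
  have hc1 : c ≤ 1 / 56000 := min_le_right _ _
  refine ⟨c, 160000, hc0, by norm_num, ?_⟩
  intro V _ _ _ _ G _ n d lam hcard hconn hreg hlam0 hexp s hs
  have hnonempty := hconn.nonempty
  rcases Nat.eq_zero_or_pos d with rfl | hd
  -- A non-zero integer power of `0` is `0` by convention, so the claimed bound is trivial here.
  · rw [Nat.cast_zero, zero_zpow _ (by omega), mul_zero, Real.exp_zero, sub_self]
    exact measureReal_nonneg
  have hd1 : (1 : ℝ) ≤ d := by exact_mod_cast hd
  set m := (n : ℝ) * (d : ℝ) ^ (-4 * ((s : ℤ) + 1)) with hm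
  have hm0 : 0 ≤ m := by positivity
  have hzpow : (d : ℝ) ^ (-4 * ((s : ℤ) + 1)) = ((d : ℝ) ^ (4 * (s + 1)))⁻¹ := by
    rw [← zpow_natCast, ← zpow_neg]; push_cast; ring_nf
  have hmn : m ≤ n := by
    rw [hm, hzpow]
    exact mul_le_of_le_one_right (Nat.cast_nonneg n) (inv_le_one_of_one_le₀ (one_le_pow₀ hd1))
  have hgoal : -c * (n : ℝ) * (d : ℝ) ^ (-4 * ((s : ℤ) + 1)) = -(c * m) := by rw [hm]; ring
  have hlin : 1 - Real.exp (-(c * m)) ≤ c * m := by linarith [Real.add_one_le_exp (-(c * m))]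
  rw [hgoal]
  rcases lt_or_ge n 40000 with hn | hn
  · have hn' : (n : ℝ) ≤ 40000 := by exact_mod_cast hn.le
    have h1 : c * m ≤ δ := (mul_le_mul_of_nonneg_left (hmn.trans hn') hc0.le).trans hcδ
    have h2 := SocialNetwork.le_modelLaw_real_of_many_walkers hreg hd (Classical.arbitrary V)
      40000 s (by norm_num)
    refine (hlin.trans h1).trans (h2.trans (measureReal_mono ?_ (measure_ne_top _ _)))
    rintro ω ⟨a, ha⟩
    refine ⟨a, ?_⟩
    have ha' : (40000 : ℝ) ≤ ((SocialNetwork.acquaintanceClass ω s a).ncard : ℝ) := by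
      exact_mod_cast ha
    linarith
  · subst hcard
    have hn' : (40000 : ℝ) ≤ Fintype.card V := by exact_mod_cast hn
    have hls : 160000 ≤ lam * s := by
      have := Nat.le_ceil (160000 / lam)
      rw [← hs, div_le_iff₀ hlam0] at this
      linarith
    have h1 := SocialNetwork.le_modelLaw_real_of_large hreg hd hconn hexp hlam0 hn hls
    refine le_trans ?_ h1
    have hd2 := SocialNetwork.two_le_of_connected hreg hconn (by omega)
    -- `d + 1 ≤ d ^ 2` because `2 ≤ d`; this is what produces the exponent `4`.
    have hL : (((d + 1 : ℕ) : ℝ) ^ s) ^ 2 ≤ (d : ℝ) ^ (4 * (s + 1)) := by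
      have h : ((d + 1) ^ s) ^ 2 ≤ d ^ (4 * (s + 1)) := by
        calc ((d + 1) ^ s) ^ 2 ≤ ((d ^ 2) ^ s) ^ 2 :=
              Nat.pow_le_pow_left (Nat.pow_le_pow_left (by nlinarith) s) 2
          _ = d ^ (4 * s) := by rw [← pow_mul, ← pow_mul]; ring_nf
          _ ≤ d ^ (4 * (s + 1)) := Nat.pow_le_pow_right hd (by omega)
      exact_mod_cast h
    have hE1 : Real.exp (-(Fintype.card V / 200 / (((d + 1 : ℕ) : ℝ) ^ s) ^ 2)) ≤
        Real.exp (-(m / 2800)) := by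
      refine Real.exp_le_exp.2 (neg_le_neg ?_)
      have h2 : m / 200 ≤ Fintype.card V / 200 / (((d + 1 : ℕ) : ℝ) ^ s) ^ 2 := by
        rw [hm, hzpow, mul_div_right_comm, ← div_eq_mul_inv]
        exact div_le_div_of_nonneg_left (by positivity) (by positivity) hL
      linarith
    have hE2 : Real.exp (-(Fintype.card V / 2800)) ≤ Real.exp (-(m / 2800)) :=
      Real.exp_le_exp.2 (by linarith)
    -- For small `m` the constant bound suffices: `c * m ≤ 1/10 < 1 - 4/5 - 1/15`. For `m ≥ 5600`
    -- the factor `2` from adding two exponentials is absorbed by `exp (m / 5600) ≥ 2`.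
    rcases lt_or_ge m 5600 with hm' | hm'
    · have h3 : Real.exp (-((Fintype.card V : ℝ) / 2800)) ≤ 1 / 15 := by
        rw [Real.exp_neg, ← one_div]
        refine one_div_le_one_div_of_le (by norm_num) ?_
        linarith [Real.add_one_le_exp ((Fintype.card V : ℝ) / 2800)]
      have h4 := min_le_right
        (Real.exp (-(Fintype.card V / 200 / (((d + 1 : ℕ) : ℝ) ^ s) ^ 2))) (4 / 5)
      have h5 : c * m ≤ 1 / 56000 * 5600 := mul_le_mul hc1 hm'.le hm0 (by norm_num)
      linarith
    · have h4 := min_le_left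
        (Real.exp (-(Fintype.card V / 200 / (((d + 1 : ℕ) : ℝ) ^ s) ^ 2))) (4 / 5)
      have h5 : 2 * Real.exp (-(m / 2800)) ≤ Real.exp (-(c * m)) := by
        calc 2 * Real.exp (-(m / 2800)) ≤ Real.exp (m / 5600) * Real.exp (-(m / 2800)) :=
              mul_le_mul_of_nonneg_right
                (by linarith [Real.add_one_le_exp (m / 5600)]) (Real.exp_pos _).le
          _ = Real.exp (-(m / 5600)) := by rw [← Real.exp_add]; congr 1; ring
          _ ≤ Real.exp (-(c * m)) := by
              refine Real.exp_le_exp.2 (neg_le_neg ?_)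
              have := mul_le_mul_of_nonneg_right hc1 hm0
              linarith
      linarith
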